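/- Let $X,Y$ be nonempty finite sets (inputs) and $A,B$ finite sets (outputs). A *quantum model* is a tuple $S=(H_A,H_B,\{M^x_a\},\{N^y_b\},|\psi\rangle)$, where $H_A,H_B$ are finite-dimensional complex Hilbert spaces, $\{M^x_a\}_{a\in A}$ is a POVM on $H_A$ for every $x\in X$, $\{N^y_b\}_{b\in B}$ is a POVM on $H_B$ for every $y\in Y$, and $|\psi\rangle\in H_A\otimes H_B$ is a unit vector. It is a model *for* $p\in\mathbb R^{A\times B\times X\times Y}$ if $p(a,b|x,y)=\langle\psi|M^x_a\otimes N^y_b|\psi\rangle$ for all $a,b,x,y$. Let $C_q=C_q(X,Y,A,B)$ be the set of all $p$ that have a quantum model. A model is *full-rank* if $\dim H_A=\dim H_B$ is the Schmidt rank of $|\psi\rangle$. A model $\widetilde S$ is a *local dilation* of $S$, written $S\succeq\widetilde S$, if there are finite-dimensional Hilbert spaces $K_A,K_B$, a unit vector $|aux\rangle\in K_A\otimes K_B$, and isometries $I_A:H_A\to\widetilde H_A\otimes K_A$, $I_B:H_B\to\widetilde H_B\otimes K_B$ such that, up to reordering of the tensor factors, $(I_A\otimes I_B)(M^x_a\otimes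 N^y_b)|\psi\rangle=\big((\widetilde M^x_a\otimes\widetilde N^y_b)|\widetilde\psi\rangle\big)\otimes|aux\rangle$ for all $a,b,x,y$. *Local equivalence* of two models means that there are unitaries $U_A:H_A\to\widetilde H_A$, $U_B:H_B\to\widetilde H_B$ with $(U_A\otimes U_B)|\psi\rangle=|\widetilde\psi\rangle$, $U_AM^x_aU_A^*=\widetilde M^x_a$ and $U_BN^y_bU_B^*=\widetilde N^y_b$. A *submodel* of $S$ is a model $(\Pi_AH_A,\Pi_BH_B,\{\Pi_AM^x_a\Pi_A\},\{\Pi_BN^y_b\Pi_B\},|\varphi\rangle)$, where $\Pi_A,\Pi_B$ are orthogonal projections that commute with all $M^x_a$ and with all $N^y_b$ respectively, and $(\Pi_A\otimes\Pi_B)|\psi\rangle=\lambda|\varphi\rangle$ for some $\lambda\neq0$. A class $\mathcal C$ of quantum models is *closed* if it contains every model that is locally equivalent to a submodel of a member of $\mathcal C$. The correlation $p$ is a *self-test for $\mathcal C$* if $\mathcal C$ contains a model $\widetilde S$ for $p$ such that $S\succeq\widetilde S$ for every model $S\in\mathcal C$ for $p$. Let $\mathrm{POVM}^{X,A}$ be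 the universal $C^*$-algebra generated by positive contractions $m^x_a$ ($x\in X$, $a\in A$) with $\sum_a m^x_a=1$ for all $x$, and define $\mathrm{POVM}^{Y,B}$ with generators $n^y_b$ likewise. A model $S$ determines representations $\phi_A(m^x_a)=M^x_a$ and $\phi_B(n^y_b)=N^y_b$, and hence the abstract state $f_S(t)=\langle\psi|(\phi_A\otimes\phi_B)(t)|\psi\rangle$ on $\mathrm{POVM}^{X,A}\otimes_{\min}\mathrm{POVM}^{Y,B}$. The correlation $p$ is an *abstract state self-test* for a set $\mathcal S$ of states on this algebra if there is exactly one $f\in\mathcal S$ with $f(m^x_a\otimes n^y_b)=p(a,b|x,y)$ for all $a,b,x,y$. **Theorem.** Let $p\in\mathbb R^{A\times B\times X\times Y}$, let $\mathcal C$ be a closed class of quantum models, and let $\mathcal S=\{f_S:S\in\mathcal C\}$. 1. If $p$ is an extreme point of $C_q$ and $\mathcal C$ contains a full-rank model for $p$, then $p$ is a self-test for $\mathcal C$ if and only if $p$ is an abstract state self-test for $\mathcal S$. 2. If $p$ is an extreme point of $C_q$ and $p$ is an abstract state self-test for $\mathcal S$, then $p$ is a self-test for $\mathcal C$ (no full-rank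 model is needed). 3. If $\mathcal C$ contains a full-rank model for $p$ and $p$ is a self-test for $\mathcal C$, then $p$ is an abstract state self-test for $\mathcal S$ (extremality is not needed). -/

import Mathlib

open scoped TensorProduct ENNReal

noncomputable section

namespace QSelfTest

universe u v w

/-! ### POVMs -/

/-- A family `{M^x_a}` of POVMs on `H`, one for each input `x : X`, with outcomes in `A`. -/
structure POVMFamily (X : Type v) (A : Type w) [Fintype A] (H : Type u)
    [NormedAddCommGroup H] [InnerProductSpace ℂ H] where
  op : X → A → H →L[ℂ] H
  pos : ∀ x a, (op x a).IsPositive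
  sum_eq_one : ∀ x, ∑ a, op x a = 1

theorem POVMFamily.norm_op_le {X : Type v} {A : Type w} [Fintype A] {H : Type u}
    [NormedAddCommGroup H] [InnerProductSpace ℂ H] [CompleteSpace H]
    (M : POVMFamily X A H) (x : X) (a : A) : ‖M.op x a‖ ≤ 1 := by
  have h0 : ∀ a, 0 ≤ M.op x a := fun a =>
    (ContinuousLinearMap.nonneg_iff_isPositive _).2 (M.pos x a)
  have h1 : M.op x a ≤ 1 := by
    rw [← M.sum_eq_one x]
    exact Finset.single_le_sum (fun i _ => h0 i) (Finset.mem_univ a)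
  exact (CStarAlgebra.norm_le_one_iff_of_nonneg _ (h0 a)).2 h1

/-- A family of POVMs on some nonzero Hilbert space, bundled with the space. -/
structure POVMRep (X : Type v) (A : Type w) [Fintype A] where
  H : Type
  [normed : NormedAddCommGroup H]
  [inner : InnerProductSpace ℂ H]
  [complete : CompleteSpace H]
  [nontriv : Nontrivial H]
  povm : POVMFamily X A H

attribute [instance] POVMRep.normed POVMRep.inner POVMRep.complete POVMRep.nontriv

/-! ### Products of C*-algebras -/

/-- The C*-algebraic product of a family of nonzero unital C*-algebras: all bounded families
`(t_i)` with `t_i ∈ B_i`, with the norm `sup_i ‖t_i‖` and the entrywise operations. -/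
def CStarProd {I : Type v} (B : I → Type w) [∀ i, CStarAlgebra (B i)] : Type (max v w) :=
  ↥(lp B ∞)

namespace CStarProd

variable {I : Type v} (B : I → Type w) [∀ i, CStarAlgebra (B i)]

instance [∀ i, Nontrivial (B i)] : CStarAlgebra (CStarProd B) :=
  { (inferInstance : NormedRing (lp B ∞)), (inferInstance : StarRing (lp B ∞)),
    (inferInstance : CompleteSpace (lp B ∞)), (inferInstance : CStarRing (lp B ∞)),
    (inferInstance : NormedAlgebra ℂ (lp B ∞)), (inferInstance : StarModule ℂ (lp B ∞)) with }

variable {B}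

/-- The element of the product given by a bounded family. -/
def mk (t : ∀ i, B i) (C : ℝ) (ht : ∀ i, ‖t i‖ ≤ C) : CStarProd B :=
  ⟨t, memℓp_infty ⟨C, by rintro _ ⟨i, rfl⟩; exact ht i⟩⟩

/-- The coordinate projection onto `B_i`. -/
def eval [∀ i, Nontrivial (B i)] (i : I) : CStarProd B →⋆ₐ[ℂ] B i where
  toFun t := (show lp B ∞ from t) i
  map_one' := rfl
  map_mul' _ _ := rfl
  map_zero' := rfl
  map_add' _ _ := rfl
  commutes' _ := rfl
  map_star' _ := rfl

theorem eval_mk [∀ i, Nontrivial (B i)] (t : ∀ i, B i) (C : ℝ) (ht : ∀ i, ‖t i‖ ≤ C) (i : I) :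
    eval i (mk t C ht) = t i := rfl

end CStarProd

/-- The C*-subalgebra generated by a subset `s` of a C*-algebra: the closure of the unital
*-subalgebra generated by `s`. -/
def CStarGen {D : Type v} [CStarAlgebra D] (s : Set D) : Type v :=
  ↥((StarAlgebra.adjoin ℂ s).topologicalClosure)

namespace CStarGen

variable {D : Type v} [CStarAlgebra D] {s : Set D}

instance : CStarAlgebra (CStarGen s) :=
  StarSubalgebra.cstarAlgebra ((StarAlgebra.adjoin ℂ s).topologicalClosure)
    (h_closed := StarSubalgebra.isClosed_topologicalClosure _)

/-- An element of the generating set. -/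
def of (d : D) (hd : d ∈ s) : CStarGen s :=
  ⟨d, StarSubalgebra.le_topologicalClosure _ (StarAlgebra.subset_adjoin ℂ s hd)⟩

/-- The inclusion. -/
def val : CStarGen s →⋆ₐ[ℂ] D :=
  StarSubalgebra.subtype ((StarAlgebra.adjoin ℂ s).topologicalClosure)

theorem val_of (d : D) (hd : d ∈ s) : val (of d hd) = d := rfl

end CStarGen

/-! ### The POVM algebra -/

/-- The generator `e^x_a` realised in all families of POVMs simultaneously. -/
def universalGen {X : Type v} {A : Type w} [Fintype A] (x : X) (a : A) :
    CStarProd (fun ρ : POVMRep X A => ρ.H →L[ℂ] ρ.H) :=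
  CStarProd.mk (fun ρ => ρ.povm.op x a) 1 fun ρ => ρ.povm.norm_op_le x a

/-- The universal C*-algebra of `X`-indexed POVMs with outcomes in `A`, as the closed *-algebra
generated by the universal family, so that the norm of a *-polynomial in the generators
is the supremum of its norms over all families of POVMs on Hilbert spaces. -/
def POVMAlg (X : Type v) (A : Type w) [Fintype A] : Type (max 1 v w) :=
  CStarGen (Set.range fun i : X × A => universalGen i.1 i.2)

namespace POVMAlg

variable {X : Type v} {A : Type w} [Fintype A]

instance : CStarAlgebra (POVMAlg X A) :=
  inferInstanceAs (CStarAlgebra (CStarGen (Set.range fun i : X × A => universalGen i.1 i.2)))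

/-- The generator `e^x_a` of the POVM algebra. -/
def gen (x : X) (a : A) : POVMAlg X A :=
  CStarGen.of (universalGen x a) ⟨(x, a), rfl⟩

/-- The representation of the POVM algebra with `e^x_a ↦ M^x_a`. -/
def lift {H : Type} [NormedAddCommGroup H] [InnerProductSpace ℂ H] [CompleteSpace H]
    [Nontrivial H] (M : POVMFamily X A H) : POVMAlg X A →⋆ₐ[ℂ] (H →L[ℂ] H) :=
  (CStarProd.eval (B := fun ρ : POVMRep X A => ρ.H →L[ℂ] ρ.H) ⟨H, M⟩).comp CStarGen.val

theorem lift_gen {H : Type} [NormedAddCommGroup H] [InnerProductSpace ℂ H] [CompleteSpace H]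
    [Nontrivial H] (M : POVMFamily X A H) (x : X) (a : A) : lift M (gen x a) = M.op x a := rfl

end POVMAlg

/-! ### The minimal tensor product -/

/-- The Hilbert space tensor product: the completion of the algebraic tensor product. -/
abbrev HilbertTensor (H K : Type u) [NormedAddCommGroup H] [InnerProductSpace ℂ H]
    [NormedAddCommGroup K] [InnerProductSpace ℂ K] : Type u :=
  UniformSpace.Completion (H ⊗[ℂ] K)

section opTensor

variable {H K : Type u} [NormedAddCommGroup H] [InnerProductSpace ℂ H]
  [NormedAddCommGroup K] [InnerProductSpace ℂ K]

instance [Nontrivial H] [Nontrivial K] : Nontrivial (HilbertTensor H K) := by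
  obtain ⟨x, hx⟩ := exists_ne (0 : H)
  obtain ⟨y, hy⟩ := exists_ne (0 : K)
  refine ⟨⟨((x ⊗ₜ[ℂ] y : H ⊗[ℂ] K) : HilbertTensor H K), 0, fun h => ?_⟩⟩
  have h1 : ‖((x ⊗ₜ[ℂ] y : H ⊗[ℂ] K) : HilbertTensor H K)‖ = ‖x‖ * ‖y‖ := by
    rw [UniformSpace.Completion.norm_coe, TensorProduct.norm_tmul]
  rw [h, norm_zero] at h1
  exact mul_ne_zero (norm_ne_zero_iff.2 hx) (norm_ne_zero_iff.2 hy) h1.symm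

/-- The bounded operator `S ⊗ T` on the Hilbert space tensor product. -/
def opTensor (S : H →L[ℂ] H) (T : K →L[ℂ] K) : HilbertTensor H K →L[ℂ] HilbertTensor H K :=
  (TensorProduct.mapL S T).completion

theorem norm_opTensor_le (S : H →L[ℂ] H) (T : K →L[ℂ] K) : ‖opTensor S T‖ ≤ ‖S‖ * ‖T‖ := by
  refine ContinuousLinearMap.opNorm_le_bound _ (by positivity) fun z => ?_
  induction z using UniformSpace.Completion.induction_on with
  | hp => exact isClosed_le (by fun_prop) (by fun_prop)
  | ih z =>
    rw [opTensor, ContinuousLinearMap.completion_apply_coe, UniformSpace.Completion.norm_coe,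
      UniformSpace.Completion.norm_coe]
    exact (ContinuousLinearMap.le_opNorm _ _).trans
      (mul_le_mul_of_nonneg_right (TensorProduct.norm_mapL_le S T) (norm_nonneg _))

end opTensor

/-- A pair of representations of two C*-algebras on nonzero Hilbert spaces in `Type u`. -/
structure RepPair (A : Type v) (B : Type w) [CStarAlgebra A] [CStarAlgebra B] where
  H : Type u
  K : Type u
  [normedH : NormedAddCommGroup H]
  [innerH : InnerProductSpace ℂ H]
  [completeH : CompleteSpace H]
  [nontrivH : Nontrivial H]
  [normedK : NormedAddCommGroup K]
  [innerK : InnerProductSpace ℂ K]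
  [completeK : CompleteSpace K]
  [nontrivK : Nontrivial K]
  left : A →⋆ₐ[ℂ] (H →L[ℂ] H)
  right : B →⋆ₐ[ℂ] (K →L[ℂ] K)

attribute [instance] RepPair.normedH RepPair.innerH RepPair.completeH RepPair.nontrivH
  RepPair.normedK RepPair.innerK RepPair.completeK RepPair.nontrivK

/-- The elementary tensor `a ⊗ b` realised as `π_A(a) ⊗ π_B(b)` in all pairs of
representations simultaneously. -/
def universalTmul {A : Type v} {B : Type w} [CStarAlgebra A] [CStarAlgebra B] (a : A) (b : B) :
    CStarProd (fun ρ : RepPair.{u} A B => HilbertTensor ρ.H ρ.K →L[ℂ] HilbertTensor ρ.H ρ.K) :=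
  CStarProd.mk (fun ρ => opTensor (ρ.left a) (ρ.right b)) (‖a‖ * ‖b‖) fun _ =>
    (norm_opTensor_le _ _).trans (mul_le_mul (NonUnitalStarAlgHom.norm_apply_le _ _)
      (NonUnitalStarAlgHom.norm_apply_le _ _) (norm_nonneg _) (norm_nonneg _))

/-- The minimal tensor product of two C*-algebras: the closed *-algebra generated by the
elementary tensors, where the norm of a sum of elementary tensors is the supremum of its norms
over all representations of the form `π_A ⊗ π_B`.  The representations are on Hilbert spaces in
`Type u`; this is the minimal C*-norm as soon as these separate the points of `A` and of `B`,
which for POVM algebras holds with `u = 0`, by construction. -/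
def MinTensor (A : Type v) (B : Type w) [CStarAlgebra A] [CStarAlgebra B] :
    Type (max (u + 1) v w) :=
  CStarGen (Set.range fun i : A × B => universalTmul.{u} i.1 i.2)

namespace MinTensor

variable {A : Type v} {B : Type w} [CStarAlgebra A] [CStarAlgebra B]

instance : CStarAlgebra (MinTensor.{u} A B) :=
  inferInstanceAs (CStarAlgebra (CStarGen (Set.range fun i : A × B => universalTmul.{u} i.1 i.2)))

/-- The elementary tensor `a ⊗ b`. -/
def tmul (a : A) (b : B) : MinTensor.{u} A B :=
  CStarGen.of (universalTmul.{u} a b) ⟨(a, b), rfl⟩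

/-- The representation `π_A ⊗ π_B` of the minimal tensor product. -/
def rep {H K : Type u} [NormedAddCommGroup H] [InnerProductSpace ℂ H] [CompleteSpace H]
    [Nontrivial H] [NormedAddCommGroup K] [InnerProductSpace ℂ K] [CompleteSpace K]
    [Nontrivial K] (π : A →⋆ₐ[ℂ] (H →L[ℂ] H)) (σ : B →⋆ₐ[ℂ] (K →L[ℂ] K)) :
    MinTensor.{u} A B →⋆ₐ[ℂ] (HilbertTensor H K →L[ℂ] HilbertTensor H K) :=
  (CStarProd.eval (B := fun ρ : RepPair.{u} A B =>
    HilbertTensor ρ.H ρ.K →L[ℂ] HilbertTensor ρ.H ρ.K) ⟨H, K, π, σ⟩).comp CStarGen.val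

theorem rep_tmul {H K : Type u} [NormedAddCommGroup H] [InnerProductSpace ℂ H] [CompleteSpace H]
    [Nontrivial H] [NormedAddCommGroup K] [InnerProductSpace ℂ K] [CompleteSpace K]
    [Nontrivial K] (π : A →⋆ₐ[ℂ] (H →L[ℂ] H)) (σ : B →⋆ₐ[ℂ] (K →L[ℂ] K)) (a : A) (b : B) :
    rep π σ (tmul a b) = opTensor (π a) (σ b) := rfl

end MinTensor

/-- A state on a C*-algebra: a linear functional, nonnegative on the positive elements
`a* a`, with value `1` at the unit. -/
structure State (A : Type v) [CStarAlgebra A] where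
  toFun : A →ₗ[ℂ] ℂ
  nonneg : ∀ a, 0 ≤ (toFun (star a * a)).re ∧ (toFun (star a * a)).im = 0
  map_one : toFun 1 = 1

/-! ### Quantum models -/

/-- A (finite-dimensional, POVM) quantum model. -/
structure QModel (X Y A B : Type*) [Fintype A] [Fintype B] where
  HA : Type
  HB : Type
  [normedA : NormedAddCommGroup HA]
  [innerA : InnerProductSpace ℂ HA]
  [finA : FiniteDimensional ℂ HA]
  [normedB : NormedAddCommGroup HB]
  [innerB : InnerProductSpace ℂ HB]
  [finB : FiniteDimensional ℂ HB]
  M : POVMFamily X A HA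
  N : POVMFamily Y B HB
  ψ : HA ⊗[ℂ] HB
  norm_ψ : ‖ψ‖ = 1

attribute [instance] QModel.normedA QModel.innerA QModel.finA
  QModel.normedB QModel.innerB QModel.finB

namespace QModel

variable {X Y A B : Type*} [Fintype A] [Fintype B]

instance (S : QModel X Y A B) : CompleteSpace S.HA := FiniteDimensional.complete ℂ _

instance (S : QModel X Y A B) : CompleteSpace S.HB := FiniteDimensional.complete ℂ _

instance (S : QModel X Y A B) : Nontrivial S.HA := by
  by_contra h
  rw [not_nontrivial_iff_subsingleton] at h
  have h0 : S.ψ = 0 := Subsingleton.elim _ _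
  have h1 := S.norm_ψ
  simp [h0] at h1

instance (S : QModel X Y A B) : Nontrivial S.HB := by
  by_contra h
  rw [not_nontrivial_iff_subsingleton] at h
  have h0 : S.ψ = 0 := Subsingleton.elim _ _
  have h1 := S.norm_ψ
  simp [h0] at h1

/-- `S` is a model for `p`, i.e. `p(a,b|x,y) = ⟨ψ| M^x_a ⊗ N^y_b |ψ⟩`;
here `p a b x y` stands for `p(a,b|x,y)`. -/
def IsModelFor (S : QModel X Y A B) (p : A → B → X → Y → ℝ) : Prop :=
  ∀ a b x y, inner ℂ S.ψ (TensorProduct.mapL (S.M.op x a) (S.N.op y b) S.ψ) = (p a b x y : ℂ)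

/-- The representation of the minimal tensor product of the POVM algebras associated with `S`. -/
def assocRep (S : QModel X Y A B) :
    MinTensor.{0} (POVMAlg X A) (POVMAlg Y B) →⋆ₐ[ℂ]
      (HilbertTensor S.HA S.HB →L[ℂ] HilbertTensor S.HA S.HB) :=
  MinTensor.rep (POVMAlg.lift S.M) (POVMAlg.lift S.N)

/-- The abstract state `f_S` defined by `S`: `f_S(t) = ⟨ψ| (φ_A ⊗ φ_B)(t) |ψ⟩`. -/
def state (S : QModel X Y A B) : State (MinTensor.{0} (POVMAlg X A) (POVMAlg Y B)) where
  toFun :=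
    { toFun := fun t => inner ℂ (S.ψ : HilbertTensor S.HA S.HB) (S.assocRep t S.ψ)
      map_add' := fun s t => by rw [map_add, _root_.add_apply, inner_add_right]
      map_smul' := fun c t => by
        rw [map_smul, _root_.smul_apply, inner_smul_right]; rfl }
  nonneg := fun t => by
    have h : inner ℂ (S.ψ : HilbertTensor S.HA S.HB) (S.assocRep (star t * t) S.ψ)
        = inner ℂ (S.assocRep t S.ψ) (S.assocRep t S.ψ) := by
      rw [map_mul, map_star, mul_apply_eq_comp,
        ContinuousLinearMap.star_eq_adjoint, ContinuousLinearMap.adjoint_inner_right]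
    refine ⟨?_, ?_⟩
    · change 0 ≤ (inner ℂ (S.ψ : HilbertTensor S.HA S.HB) (S.assocRep (star t * t) S.ψ)).re
      rw [h]
      exact inner_self_nonneg (𝕜 := ℂ)
    · change (inner ℂ (S.ψ : HilbertTensor S.HA S.HB) (S.assocRep (star t * t) S.ψ)).im = 0
      rw [h]
      exact inner_self_im (𝕜 := ℂ) _
  map_one := by
    change inner ℂ (S.ψ : HilbertTensor S.HA S.HB) (S.assocRep 1 S.ψ) = 1
    rw [map_one, one_apply_eq_self, inner_self_eq_norm_sq_to_K,
      UniformSpace.Completion.norm_coe, S.norm_ψ]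
    simp

/-- `ψ` has Schmidt rank `n`: it has a Schmidt decomposition with `n` terms. -/
def HasSchmidtRank {H K : Type*} [NormedAddCommGroup H] [InnerProductSpace ℂ H]
    [NormedAddCommGroup K] [InnerProductSpace ℂ K] (ψ : H ⊗[ℂ] K) (n : ℕ) : Prop :=
  ∃ (c : Fin n → ℝ) (α : Fin n → H) (β : Fin n → K),
    (∀ i, 0 < c i) ∧ Orthonormal ℂ α ∧ Orthonormal ℂ β ∧
      ψ = ∑ i, (c i : ℂ) • (α i ⊗ₜ[ℂ] β i)

/-- A model is full-rank if `dim H_A = dim H_B` is the Schmidt rank of `ψ`. -/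
def IsFullRank (S : QModel X Y A B) : Prop :=
  Module.finrank ℂ S.HA = Module.finrank ℂ S.HB ∧
    HasSchmidtRank S.ψ (Module.finrank ℂ S.HA)

/-- `S.LocallyDilatesTo T`, in symbols `S ⪰ T`: the model `T` is a local dilation of `S`.  The
canonical reordering `(T_A ⊗ T_B) ⊗ (K_A ⊗ K_B) ≃ (T_A ⊗ K_A) ⊗ (T_B ⊗ K_B)` is made explicit. -/
def LocallyDilatesTo (S T : QModel X Y A B) : Prop :=
  ∃ (KA KB : Type) (_ : NormedAddCommGroup KA) (_ : InnerProductSpace ℂ KA)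
    (_ : FiniteDimensional ℂ KA) (_ : NormedAddCommGroup KB) (_ : InnerProductSpace ℂ KB)
    (_ : FiniteDimensional ℂ KB) (aux : KA ⊗[ℂ] KB)
    (IA : S.HA →ₗᵢ[ℂ] T.HA ⊗[ℂ] KA) (IB : S.HB →ₗᵢ[ℂ] T.HB ⊗[ℂ] KB),
    ‖aux‖ = 1 ∧
    ∀ a b x y,
      TensorProduct.map IA.toLinearMap IB.toLinearMap
          (TensorProduct.mapL (S.M.op x a) (S.N.op y b) S.ψ) =
        TensorProduct.tensorTensorTensorComm ℂ T.HA T.HB KA KB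
          ((TensorProduct.mapL (T.M.op x a) (T.N.op y b) T.ψ) ⊗ₜ[ℂ] aux)

/-- Local equivalence `S ≅ T`. -/
def LocallyEquivalent (S T : QModel X Y A B) : Prop :=
  ∃ (UA : S.HA ≃ₗᵢ[ℂ] T.HA) (UB : S.HB ≃ₗᵢ[ℂ] T.HB),
    TensorProduct.map UA.toLinearEquiv.toLinearMap UB.toLinearEquiv.toLinearMap S.ψ = T.ψ ∧
    (∀ x a v, UA (S.M.op x a (UA.symm v)) = T.M.op x a v) ∧
    (∀ y b v, UB (S.N.op y b (UB.symm v)) = T.N.op y b v)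

end QModel

/-- The compression `{Π M^x_a Π}` of a family of POVMs to a subspace `V` with projection `Π`,
as a family of POVMs on `V`. -/
def POVMFamily.compress {X : Type v} {A : Type w} [Fintype A] {H : Type u}
    [NormedAddCommGroup H] [InnerProductSpace ℂ H] (M : POVMFamily X A H)
    (V : Submodule ℂ H) [CompleteSpace H] [CompleteSpace V] : POVMFamily X A V where
  op x a := V.orthogonalProjectionOnto ∘L M.op x a ∘L V.subtypeL
  pos x a := by
    have h := (M.pos x a).conj_adjoint V.orthogonalProjectionOnto
    rwa [Submodule.adjoint_orthogonalProjectionOnto] at h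
  sum_eq_one x := by
    ext v
    have h : ∑ a, M.op x a (v : H) = v := by
      have := congrArg (fun T : H →L[ℂ] H => T (v : H)) (M.sum_eq_one x)
      simpa [_root_.sum_apply] using this
    simp [← map_sum, h]

namespace QModel

variable {X Y A B : Type*} [Fintype A] [Fintype B]

/-- The model on `V_A ⊗ V_B` with compressed POVMs and a unit vector `φ ∈ V_A ⊗ V_B`. -/
def compress (S : QModel X Y A B) (VA : Submodule ℂ S.HA) (VB : Submodule ℂ S.HB)
    (φ : VA ⊗[ℂ] VB) (hφ : ‖φ‖ = 1) : QModel X Y A B where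
  HA := VA
  HB := VB
  M := S.M.compress VA
  N := S.N.compress VB
  ψ := φ
  norm_ψ := hφ

/-- `T.IsSubmodelOf S`: `T` lives on `V_A = Π_A H_A` and `V_B = Π_B H_B`, has the compressed
operators `Π_A M^x_a Π_A`, `Π_B N^y_b Π_B`, its vector `φ` satisfies
`(Π_A ⊗ Π_B) ψ = c φ` with `c ≠ 0`, and the projections commute with the operators of `S`. -/
def IsSubmodelOf (T S : QModel X Y A B) : Prop :=
  ∃ (VA : Submodule ℂ S.HA) (VB : Submodule ℂ S.HB) (φ : VA ⊗[ℂ] VB) (hφ : ‖φ‖ = 1),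
    T = S.compress VA VB φ hφ ∧
    (∃ c : ℂ, c ≠ 0 ∧
      TensorProduct.mapL VA.starProjection VB.starProjection S.ψ =
        c • TensorProduct.map VA.subtype VB.subtype φ) ∧
    (∀ x a, Commute VA.starProjection (S.M.op x a)) ∧
    (∀ y b, Commute VB.starProjection (S.N.op y b))

end QModel

/-! ### Correlations, classes of models and self-tests -/

section

variable {X Y A B : Type*} [Fintype A] [Fintype B]

/-- The set `C_q(X, Y, A, B)` of correlations that have a quantum model. -/
def Cq (X Y A B : Type*) [Fintype A] [Fintype B] : Set (A → B → X → Y → ℝ) :=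
  {p | ∃ S : QModel X Y A B, S.IsModelFor p}

/-- A class of models is closed if it contains every model that is locally equivalent to a
submodel of one of its members. -/
def IsClosedClass (𝒞 : Set (QModel X Y A B)) : Prop :=
  ∀ S ∈ 𝒞, ∀ S' T : QModel X Y A B, S'.IsSubmodelOf S → T.LocallyEquivalent S' → T ∈ 𝒞

/-- `p` is a self-test for the class `𝒞`. -/
def IsSelfTest (p : A → B → X → Y → ℝ) (𝒞 : Set (QModel X Y A B)) : Prop :=
  ∃ T ∈ 𝒞, T.IsModelFor p ∧ ∀ S ∈ 𝒞, S.IsModelFor p → S.LocallyDilatesTo T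

/-- The state `f` on the minimal tensor product of the POVM algebras has correlation `p`. -/
def HasCorrelation (f : State (MinTensor.{0} (POVMAlg X A) (POVMAlg Y B)))
    (p : A → B → X → Y → ℝ) : Prop :=
  ∀ a b x y, f.toFun (MinTensor.tmul (POVMAlg.gen x a) (POVMAlg.gen y b)) = (p a b x y : ℂ)

/-- `p` is an abstract state self-test for the set `𝒮` of states. -/
def IsAbstractStateSelfTest (p : A → B → X → Y → ℝ)
    (𝒮 : Set (State (MinTensor.{0} (POVMAlg X A) (POVMAlg Y B)))) : Prop :=
  ∃! f, f ∈ 𝒮 ∧ HasCorrelation f p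

end

end QSelfTest

end

noncomputable section

/-! Write `f_S` for the abstract state of a model `S`.

From uniqueness of the state to a self-test. Among the models for `p` in the class take one, `T`, of
least total dimension. If invariant subspaces on the two sides have projections that do not kill
`ψ`, they cut out a submodel in the class; the projections commute with the measurement operators,
so `p` is a convex combination of the correlations of `Rψ` and `ψ - Rψ`, where `R` is the tensor
product of the projections, and extremality makes the submodel a model for `p`. Minimality then
forces the operators of `T` to act irreducibly on each side (`exists_irreducible_model`). Any other
model `S` for `p` has `f_S = f_T`, so uniqueness in the GNS construction gives a map `J` from the
space of `T` to that of `S` that intertwines all operators and takes vector to vector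
(`exists_intertwiner_of_state_eq`). Such a `J` is a sum of products `s ⊗ t` of one-sided
intertwiners (`exists_tensor_of_intertwines`). By Schur's lemma the images of all `s` together look
like a multiple of the irreducible space, which yields isometries with `I_A (s v) = v ⊗ s v₀`
(`exists_isometry_of_irreducible`) and likewise on the other side. Hence `(I_A ⊗ I_B) J z = z ⊗ aux`
up to reordering, with `aux = ∑ s v₀ ⊗ t w₀`, and this is the dilation.

From a self-test to uniqueness of the state. If `S` dilates to `T`, then `I_A` maps the left support
of `ψ_S` onto the product of the left supports of `ψ_T` and `aux`, and there it intertwines `M` with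
`M̃ ⊗ 1`. For a full-rank `S` that support is the whole space, so the supports of `ψ_T` are
invariant under the operators of `T` (`Dilation.isCentrallySupported_of_isFullRank`). Once this
holds, every model dilating to `T` has invariant supports too, the intertwining passes to products
and limits of generators, and the two abstract states agree on elementary tensors, hence everywhere
(`Dilation.state_eq`). -/

namespace QSelfTest

/-! ### Intertwiners -/

section Linear

open TensorProduct

variable {ι κ V W H K : Type*}
  [AddCommGroup V] [Module ℂ V] [AddCommGroup W] [Module ℂ W]
  [AddCommGroup H] [Module ℂ H] [AddCommGroup K] [Module ℂ K]

/-- The space of linear maps intertwining two families of operators. -/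
def intertwiners (m : ι → Module.End ℂ V) (n : ι → Module.End ℂ H) :
    Submodule ℂ (V →ₗ[ℂ] H) where
  carrier := {s | ∀ i, s ∘ₗ m i = n i ∘ₗ s}
  add_mem' h h' i := by rw [LinearMap.add_comp, LinearMap.comp_add, h i, h' i]
  zero_mem' i := by simp
  smul_mem' c s h i := by rw [LinearMap.smul_comp, LinearMap.comp_smul, h i]

theorem mem_intertwiners {m : ι → Module.End ℂ V} {n : ι → Module.End ℂ H} {s : V →ₗ[ℂ] H} :
    s ∈ intertwiners m n ↔ ∀ i, s ∘ₗ m i = n i ∘ₗ s := Iff.rfl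

theorem apply_of_mem_intertwiners {m : ι → Module.End ℂ V} {n : ι → Module.End ℂ H}
    {s : V →ₗ[ℂ] H} (hs : s ∈ intertwiners m n) (i : ι) (v : V) : s (m i v) = n i (s v) :=
  LinearMap.congr_fun (hs i) v

/-- The linear map whose kernel is the space of intertwiners. -/
def intertwinerDefect (m : ι → Module.End ℂ V) (n : ι → Module.End ℂ H) :
    (V →ₗ[ℂ] H) →ₗ[ℂ] (ι → (V →ₗ[ℂ] H)) :=
  LinearMap.pi fun i => (LinearMap.lcomp ℂ H (m i)) - (LinearMap.llcomp ℂ V H H (n i))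

theorem intertwinerDefect_apply (m : ι → Module.End ℂ V) (n : ι → Module.End ℂ H)
    (s : V →ₗ[ℂ] H) (i : ι) : intertwinerDefect m n s i = s ∘ₗ m i - n i ∘ₗ s := rfl

theorem ker_intertwinerDefect (m : ι → Module.End ℂ V) (n : ι → Module.End ℂ H) :
    LinearMap.ker (intertwinerDefect m n) = intertwiners m n := by
  ext s
  simp only [LinearMap.mem_ker, mem_intertwiners, funext_iff, intertwinerDefect_apply,
    Pi.zero_apply, sub_eq_zero]

/-- Tensoring commutes with finite products. Finiteness of the input sets enters the dilation
argument here. -/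
theorem eq_zero_of_rTensor_proj_eq_zero [Fintype ι] {E F : Type*} [AddCommGroup E] [Module ℂ E]
    [AddCommGroup F] [Module ℂ F] (y : (ι → E) ⊗[ℂ] F)
    (hy : ∀ i, (LinearMap.proj i : (ι → E) →ₗ[ℂ] E).rTensor F y = 0) : y = 0 := by
  classical
  have key : ∀ y : (ι → E) ⊗[ℂ] F, y = ∑ i, (LinearMap.single ℂ (fun _ : ι => E) i).rTensor F
      ((LinearMap.proj i : (ι → E) →ₗ[ℂ] E).rTensor F y) := by
    intro y
    induction y with
    | zero => simp
    | tmul e f =>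
      simp only [LinearMap.rTensor_tmul, ← TensorProduct.sum_tmul]
      congr 1
      simp [LinearMap.single_apply, Finset.univ_sum_single]
    | add y z hy' hz' => simp only [map_add, Finset.sum_add_distrib, ← hy', ← hz']
  rw [key y]
  exact Finset.sum_eq_zero fun i _ => by rw [hy i, map_zero]

/-- The elements of `E ⊗ F` killed by `f ⊗ 1` and `1 ⊗ g` come from `ker f ⊗ ker g`. -/
theorem exists_map_subtype_of_rTensor_lTensor_eq_zero {E F E' F' : Type*}
    [AddCommGroup E] [Module ℂ E] [AddCommGroup F] [Module ℂ F]
    [AddCommGroup E'] [Module ℂ E'] [AddCommGroup F'] [Module ℂ F']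
    (f : E →ₗ[ℂ] E') (g : F →ₗ[ℂ] F') (x : E ⊗[ℂ] F)
    (hf : f.rTensor F x = 0) (hg : g.lTensor E x = 0) :
    ∃ y : LinearMap.ker f ⊗[ℂ] LinearMap.ker g,
      TensorProduct.map (LinearMap.ker f).subtype (LinearMap.ker g).subtype y = x := by
  obtain ⟨z, rfl⟩ := (Module.Flat.rTensor_exact F
    (f := (LinearMap.ker f).subtype) (g := f) (LinearMap.exact_subtype_ker_map f) x).1 hf
  -- By flatness `ker f ⊗ F'` embeds in `E ⊗ F'`, where the vanishing is already known.
  have hz : g.lTensor (LinearMap.ker f) z = 0 := by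
    have hinj : Function.Injective ((LinearMap.ker f).subtype.rTensor F') :=
      Module.Flat.rTensor_preserves_injective_linearMap _ (Submodule.subtype_injective _)
    apply hinj
    rw [map_zero, ← hg, ← LinearMap.comp_apply, ← LinearMap.comp_apply,
      LinearMap.rTensor_comp_lTensor, LinearMap.lTensor_comp_rTensor]
  obtain ⟨y, rfl⟩ := (Module.Flat.lTensor_exact (LinearMap.ker f)
    (f := (LinearMap.ker g).subtype) (g := g) (LinearMap.exact_subtype_ker_map g) z).1 hz
  exact ⟨y, by rw [← LinearMap.comp_apply, LinearMap.rTensor_comp_lTensor]⟩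

/-- In `Hom(V ⊗ W, H ⊗ K) = Hom(V, H) ⊗ Hom(W, K)`, commuting with the left operators means being
killed by `defect ⊗ 1`, and with the right ones by `1 ⊗ defect`. Such tensors come from the tensor
product of the two kernels. -/
theorem exists_tensor_of_intertwines [Fintype ι] [Fintype κ]
    [FiniteDimensional ℂ V] [FiniteDimensional ℂ W] [FiniteDimensional ℂ H]
    [FiniteDimensional ℂ K]
    {m : ι → Module.End ℂ V} {n : ι → Module.End ℂ H}
    {m' : κ → Module.End ℂ W} {n' : κ → Module.End ℂ K} (J : V ⊗[ℂ] W →ₗ[ℂ] H ⊗[ℂ] K)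
    (hl : ∀ i, J ∘ₗ (m i).rTensor W = (n i).rTensor K ∘ₗ J)
    (hr : ∀ j, J ∘ₗ (m' j).lTensor V = (n' j).lTensor H ∘ₗ J) :
    ∃ x : intertwiners m n ⊗[ℂ] intertwiners m' n',
      homTensorHomMap (RingHom.id ℂ) V W H K (TensorProduct.map (intertwiners m n).subtype
        (intertwiners m' n').subtype x) = J := by
  obtain ⟨x, rfl⟩ := (homTensorHomEquiv ℂ V W H K).surjective J
  have hinj := (homTensorHomEquiv ℂ V W H K).injective
  have h1 : (intertwinerDefect m n).rTensor _ x = 0 := by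
    refine eq_zero_of_rTensor_proj_eq_zero _ fun i => hinj ?_
    have e : ∀ x : (V →ₗ[ℂ] H) ⊗[ℂ] (W →ₗ[ℂ] K), homTensorHomEquiv ℂ V W H K
        ((LinearMap.proj i : (ι → (V →ₗ[ℂ] H)) →ₗ[ℂ] _).rTensor _
          ((intertwinerDefect m n).rTensor _ x)) =
        homTensorHomEquiv ℂ V W H K x ∘ₗ (m i).rTensor W -
          (n i).rTensor K ∘ₗ homTensorHomEquiv ℂ V W H K x := by
      intro x
      induction x with
      | zero => simp
      | tmul s t =>
        ext v w
        simp [intertwinerDefect_apply, sub_tmul]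
      | add x y hx hy =>
        simp only [map_add, hx, hy, LinearMap.add_comp, LinearMap.comp_add]
        abel
    rw [e, hl i, sub_self, map_zero]
  have h2 : (intertwinerDefect m' n').lTensor _ x = 0 := by
    refine (TensorProduct.comm ℂ _ _).injective ?_
    rw [map_zero]
    refine eq_zero_of_rTensor_proj_eq_zero _ fun i =>
      (TensorProduct.comm ℂ _ _).injective (hinj ?_)
    have e : ∀ x : (V →ₗ[ℂ] H) ⊗[ℂ] (W →ₗ[ℂ] K), homTensorHomEquiv ℂ V W H K
        (TensorProduct.comm ℂ _ _
          ((LinearMap.proj i : (κ → (W →ₗ[ℂ] K)) →ₗ[ℂ] _).rTensor _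
            (TensorProduct.comm ℂ _ _ ((intertwinerDefect m' n').lTensor _ x)))) =
        homTensorHomEquiv ℂ V W H K x ∘ₗ (m' i).lTensor V -
          (n' i).lTensor H ∘ₗ homTensorHomEquiv ℂ V W H K x := by
      intro x
      induction x with
      | zero => simp
      | tmul s t =>
        ext v w
        simp [intertwinerDefect_apply, tmul_sub]
      | add x y hx hy =>
        simp only [map_add, hx, hy, LinearMap.add_comp, LinearMap.comp_add]
        abel
    rw [e, hr i, sub_self, map_zero, map_zero]
  have := exists_map_subtype_of_rTensor_lTensor_eq_zero _ _ x h1 h2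
  rw [ker_intertwinerDefect, ker_intertwinerDefect] at this
  obtain ⟨y, hy⟩ := this
  exact ⟨y, by rw [hy, homTensorHomEquiv_apply]⟩

/-- A family of operators is irreducible if it has no proper nonzero invariant subspace. -/
def IsIrreducibleFamily (m : ι → Module.End ℂ V) : Prop :=
  ∀ E : Submodule ℂ V, (∀ i, ∀ v ∈ E, m i v ∈ E) → E = ⊥ ∨ E = ⊤

/-- Schur's lemma: an eigenspace of an operator commuting with the family is invariant and nonzero.
-/
theorem IsIrreducibleFamily.exists_eq_smul [FiniteDimensional ℂ V] [Nontrivial V]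
    {m : ι → Module.End ℂ V} (hm : IsIrreducibleFamily m) {c : V →ₗ[ℂ] V}
    (hc : c ∈ intertwiners m m) : ∃ μ : ℂ, ∀ v, c v = μ • v := by
  obtain ⟨μ, hμ⟩ := Module.End.exists_eigenvalue (c : Module.End ℂ V)
  refine ⟨μ, fun v => ?_⟩
  have htop : Module.End.eigenspace (c : Module.End ℂ V) μ = ⊤ := by
    refine (hm _ fun i v hv => ?_).resolve_left hμ
    rw [Module.End.mem_eigenspace_iff] at hv ⊢
    rw [apply_of_mem_intertwiners hc, hv, map_smul]
  exact Module.End.mem_eigenspace_iff.1 (htop ▸ Submodule.mem_top)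

end Linear

/-! ### Partial isometries, and Schur's lemma for self-adjoint families -/

section Inner

open TensorProduct

variable {ι κ V W H K D : Type*}
  [NormedAddCommGroup V] [InnerProductSpace ℂ V] [FiniteDimensional ℂ V]
  [NormedAddCommGroup H] [InnerProductSpace ℂ H] [FiniteDimensional ℂ H]

/-- Equality of norms gives `ker Φ ≤ ker Ψ`, so `Φ d ↦ Ψ d` is well defined on the range of `Φ`;
precomposing with the orthogonal projection extends it by zero. The choice of the section `g` is
immaterial. -/
theorem exists_linearMap_of_norm_eq {H : Type*} [NormedAddCommGroup H] [InnerProductSpace ℂ H]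
    [AddCommGroup D] [Module ℂ D] (Φ : D →ₗ[ℂ] V)
    (Ψ : D →ₗ[ℂ] H) (h : ∀ d, ‖Φ d‖ = ‖Ψ d‖) :
    ∃ J : V →ₗ[ℂ] H, (∀ d, J (Φ d) = Ψ d) ∧ ∀ z ∈ (LinearMap.range Φ)ᗮ, J z = 0 := by
  obtain ⟨g, hg⟩ := Φ.rangeRestrict.exists_rightInverse_of_surjective Φ.range_rangeRestrict
  refine ⟨Ψ ∘ₗ g ∘ₗ ((LinearMap.range Φ).orthogonalProjectionOnto).toLinearMap,
    fun d => ?_, fun z hz => ?_⟩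
  · have h1 : (LinearMap.range Φ).orthogonalProjectionOnto (Φ d) = Φ.rangeRestrict d :=
      Submodule.orthogonalProjectionOnto_mem_subspace_eq_self (Φ.rangeRestrict d)
    have h2 : Φ (g (Φ.rangeRestrict d)) = Φ d :=
      congrArg Subtype.val (LinearMap.congr_fun hg (Φ.rangeRestrict d))
    have h3 : Ψ (g (Φ.rangeRestrict d) - d) = 0 := by
      rw [← norm_eq_zero, ← h, map_sub, h2, sub_self, norm_zero]
    change Ψ (g ((LinearMap.range Φ).orthogonalProjectionOnto (Φ d))) = Ψ d
    exact (congrArg (fun r => Ψ (g r)) h1).trans (sub_eq_zero.1 ((map_sub Ψ _ _).symm.trans h3))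
  · have h1 : (LinearMap.range Φ).orthogonalProjectionOnto z = 0 :=
      Submodule.orthogonalProjectionOnto_eq_zero_iff.2 hz
    change Ψ (g ((LinearMap.range Φ).orthogonalProjectionOnto z)) = 0
    rw [h1, map_zero, map_zero]

theorem orthogonal_invariant {V : Type*} [NormedAddCommGroup V] [InnerProductSpace ℂ V]
    {m : V →ₗ[ℂ] V} (hm : m.IsSymmetric) {E : Submodule ℂ V}
    (hE : ∀ v ∈ E, m v ∈ E) : ∀ v ∈ Eᗮ, m v ∈ Eᗮ := fun v hv => by
  rw [Submodule.mem_orthogonal] at hv ⊢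
  intro u hu
  rw [← hm u v]
  exact hv _ (hE u hu)

theorem starProjection_apply_of_invariant {m : V →ₗ[ℂ] V} (hm : m.IsSymmetric)
    {E : Submodule ℂ V} (hE : ∀ v ∈ E, m v ∈ E) (v : V) :
    E.starProjection (m v) = m (E.starProjection v) := by
  conv_lhs => rw [← E.starProjection_add_starProjection_orthogonal v]
  rw [map_add, map_add, Submodule.starProjection_eq_self_iff.2
      (hE _ (Submodule.starProjection_apply_mem _ _)),
    (Submodule.starProjection_apply_eq_zero_iff _).2
      (orthogonal_invariant hm hE _ (Submodule.starProjection_apply_mem _ _)), add_zero]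

/-- Since the operators are symmetric, `s* t` commutes with the irreducible family and is a scalar,
which is read off at the unit vector `v₀`. -/
theorem inner_intertwiners [Nontrivial V] {m : ι → Module.End ℂ V} {n : ι → Module.End ℂ H}
    (hm : ∀ i, (m i).IsSymmetric) (hn : ∀ i, (n i).IsSymmetric) (hirr : IsIrreducibleFamily m)
    {v₀ : V} (hv₀ : ‖v₀‖ = 1) {s t : V →ₗ[ℂ] H} (hs : s ∈ intertwiners m n)
    (ht : t ∈ intertwiners m n) (v w : V) :
    inner ℂ (s v) (t w) = inner ℂ v w * inner ℂ (s v₀) (t v₀) := by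
  have hc : LinearMap.adjoint s ∘ₗ t ∈ intertwiners m m := fun i => by
    ext v
    refine ext_inner_left ℂ fun w => ?_
    simp only [LinearMap.comp_apply, LinearMap.adjoint_inner_right,
      apply_of_mem_intertwiners ht]
    rw [← hm i, LinearMap.adjoint_inner_right, apply_of_mem_intertwiners hs, hn i]
  obtain ⟨μ, hμ⟩ := hirr.exists_eq_smul hc
  have key : ∀ v w, inner ℂ (s v) (t w) = μ * inner ℂ v w := fun v w => by
    rw [← LinearMap.adjoint_inner_right, ← LinearMap.comp_apply, hμ, inner_smul_right]
  rw [key, key v₀, inner_self_eq_norm_sq_to_K, hv₀]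
  simp [mul_comm]

/-- The preceding formula says that `v ⊗ s ↦ s v` and `v ⊗ s ↦ v ⊗ s v₀` have the same Gram matrix,
so `s v ↦ v ⊗ s v₀` is isometric on the span `R` of the images of all intertwiners. Using `H` itself
as auxiliary space leaves room for `Rᗮ`. -/
theorem exists_isometry_of_irreducible [Nontrivial V] {m : ι → Module.End ℂ V}
    {n : ι → Module.End ℂ H} (hm : ∀ i, (m i).IsSymmetric) (hn : ∀ i, (n i).IsSymmetric)
    (hirr : IsIrreducibleFamily m) {v₀ : V} (hv₀ : ‖v₀‖ = 1) :
    ∃ I : H →ₗᵢ[ℂ] V ⊗[ℂ] H, ∀ s ∈ intertwiners m n, ∀ v, I (s v) = v ⊗ₜ s v₀ := by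
  let Φ : V ⊗[ℂ] intertwiners m n →ₗ[ℂ] H :=
    TensorProduct.lift (LinearMap.flip (intertwiners m n).subtype)
  let Ψ : V ⊗[ℂ] intertwiners m n →ₗ[ℂ] V ⊗[ℂ] H :=
    LinearMap.lTensor V (LinearMap.applyₗ v₀ ∘ₗ (intertwiners m n).subtype)
  have hΦ : ∀ v s, Φ (v ⊗ₜ s) = s.1 v := fun _ _ => rfl
  have hΨ : ∀ v s, Ψ (v ⊗ₜ s) = v ⊗ₜ s.1 v₀ := fun _ _ => rfl
  have hin : ∀ x y, inner ℂ (Φ x) (Φ y) = inner ℂ (Ψ x) (Ψ y) := by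
    intro x y
    induction x with
    | zero => simp
    | add x x' hx hx' => simp only [map_add, inner_add_left, hx, hx']
    | tmul v s =>
      induction y with
      | zero => simp
      | add y y' hy hy' => simp only [map_add, inner_add_right, hy, hy']
      | tmul w t =>
        rw [hΦ, hΦ, hΨ, hΨ, inner_tmul, inner_intertwiners hm hn hirr hv₀ s.2 t.2]
  have hnorm : ∀ x, ‖Φ x‖ = ‖Ψ x‖ := fun x => by
    rw [@norm_eq_sqrt_re_inner ℂ, @norm_eq_sqrt_re_inner ℂ, hin]
  obtain ⟨J, hJ, -⟩ := exists_linearMap_of_norm_eq Φ Ψ hnorm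
  set R := LinearMap.range Φ with hR
  -- On `Rᗮ` the map is `h ↦ v₀ ⊗ h`. Its image is orthogonal to that of `R`, because the second
  -- legs `s v₀` lie in `R`.
  let I : H →ₗ[ℂ] V ⊗[ℂ] H := J ∘ₗ R.starProjection.toLinearMap +
    TensorProduct.mk ℂ V H v₀ ∘ₗ Rᗮ.starProjection.toLinearMap
  have hI : ∀ h, I h = J (R.starProjection h) + v₀ ⊗ₜ Rᗮ.starProjection h := fun _ => rfl
  have horth : ∀ x, ∀ z ∈ Rᗮ, inner ℂ (Ψ x) (v₀ ⊗ₜ[ℂ] z) = 0 := by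
    intro x z hz
    induction x with
    | zero => simp
    | add x y hx hy => rw [map_add, inner_add_left, hx, hy, add_zero]
    | tmul v s =>
      rw [hΨ, inner_tmul, (Submodule.mem_orthogonal _ _).1 hz (s.1 v₀) ⟨v₀ ⊗ₜ s, hΦ _ _⟩,
        mul_zero]
  have hIn : ∀ h, ‖I h‖ = ‖h‖ := fun h => by
    obtain ⟨x, hx⟩ : R.starProjection h ∈ R := Submodule.starProjection_apply_mem _ _
    have h1 := norm_add_sq_eq_norm_sq_add_norm_sq_of_inner_eq_zero (𝕜 := ℂ) (Ψ x)
      (v₀ ⊗ₜ[ℂ] Rᗮ.starProjection h) (horth x _ (Submodule.starProjection_apply_mem _ _))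
    have h2 := Submodule.norm_sq_eq_add_norm_sq_starProjection h R
    rw [hI, ← hx, hJ, ← sq_eq_sq₀ (norm_nonneg _) (norm_nonneg _), sq, h1, h2, norm_tmul, hv₀,
      ← hx, hnorm]
    ring
  refine ⟨⟨I, hIn⟩, fun s hs v => ?_⟩
  have hmem : s v ∈ R := ⟨v ⊗ₜ ⟨s, hs⟩, rfl⟩
  change I (s v) = _
  rw [hI, Submodule.starProjection_eq_self_iff.2 hmem,
    (Submodule.starProjection_apply_eq_zero_iff _).2
      (Submodule.le_orthogonal_orthogonal _ hmem), tmul_zero, add_zero]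
  exact hJ (v ⊗ₜ ⟨s, hs⟩)

end Inner

/-! ### Inner products under reordering of tensor factors -/

section Reorder

open TensorProduct

variable {V W H K : Type*}
  [NormedAddCommGroup V] [InnerProductSpace ℂ V] [NormedAddCommGroup W] [InnerProductSpace ℂ W]
  [NormedAddCommGroup H] [InnerProductSpace ℂ H] [NormedAddCommGroup K] [InnerProductSpace ℂ K]

/-! On iterated tensor products the general lemmas about inner products do not unify, so they
are restated for tensor products. -/

theorem inner_zero_tensor (y : V ⊗[ℂ] W) : inner ℂ (0 : V ⊗[ℂ] W) y = 0 := inner_zero_left _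

theorem inner_tensor_zero (y : V ⊗[ℂ] W) : inner ℂ y (0 : V ⊗[ℂ] W) = 0 := inner_zero_right _

theorem inner_add_tensor (x x' y : V ⊗[ℂ] W) :
    inner ℂ (x + x') y = inner ℂ x y + inner ℂ x' y := inner_add_left _ _ _

theorem inner_tensor_add (x y y' : V ⊗[ℂ] W) :
    inner ℂ x (y + y') = inner ℂ x y + inner ℂ x y' := inner_add_right _ _ _

theorem inner_smul_tensor (c : ℂ) (x y : V ⊗[ℂ] W) :
    inner ℂ (c • x) y = (starRingEnd ℂ) c * inner ℂ x y :=
  inner_smul_left (𝕜 := ℂ) (E := V ⊗[ℂ] W) x y c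

theorem inner_tensor_smul (c : ℂ) (x y : V ⊗[ℂ] W) :
    inner ℂ x (c • y) = c * inner ℂ x y :=
  inner_smul_right (𝕜 := ℂ) (E := V ⊗[ℂ] W) x y c

theorem inner_self_tensor (x : V ⊗[ℂ] W) : inner ℂ x x = (‖x‖ : ℂ) ^ 2 :=
  inner_self_eq_norm_sq_to_K x

theorem inner_tensorTensorTensorComm (z z' : V ⊗[ℂ] W) (u u' : H ⊗[ℂ] K) :
    inner ℂ (tensorTensorTensorComm ℂ V W H K (z ⊗ₜ u))
      (tensorTensorTensorComm ℂ V W H K (z' ⊗ₜ u')) = inner ℂ z z' * inner ℂ u u' := by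
  induction z with
  | zero => simp [inner_zero_tensor]
  | add p p' hp hp' => simp only [add_tmul, map_add, inner_add_tensor, hp, hp', add_mul]
  | tmul v w =>
  induction u with
  | zero => simp [inner_zero_tensor]
  | add p p' hp hp' => simp only [tmul_add, map_add, inner_add_tensor, hp, hp', mul_add]
  | tmul h k =>
  induction z' with
  | zero => simp [inner_tensor_zero]
  | add p p' hp hp' => simp only [add_tmul, map_add, inner_tensor_add, hp, hp', add_mul]
  | tmul v' w' =>
  induction u' with
  | zero => simp [inner_tensor_zero]
  | add p p' hp hp' => simp only [tmul_add, map_add, inner_tensor_add, hp, hp', mul_add]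
  | tmul h' k' =>
  simp only [tensorTensorTensorComm_tmul, inner_tmul]
  ring

theorem norm_tensorTensorTensorComm (z : V ⊗[ℂ] W) (u : H ⊗[ℂ] K) :
    ‖tensorTensorTensorComm ℂ V W H K (z ⊗ₜ u)‖ = ‖z‖ * ‖u‖ := by
  have h := inner_tensorTensorTensorComm z z u u
  rw [inner_self_tensor, inner_self_tensor, inner_self_tensor, ← mul_pow] at h
  exact (sq_eq_sq₀ (norm_nonneg _) (by positivity)).1 (by exact_mod_cast h)

end Reorder

/-! ### Models with equal states: intertwiners and dilations -/

namespace QModel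

open TensorProduct

variable {X Y A B : Type*} [Fintype A] [Fintype B]

/-- The operators `M^x_a` of a model. -/
def opA (S : QModel X Y A B) (i : X × A) : Module.End ℂ S.HA := (S.M.op i.1 i.2).toLinearMap

/-- The operators `N^y_b` of a model. -/
def opB (S : QModel X Y A B) (i : Y × B) : Module.End ℂ S.HB := (S.N.op i.1 i.2).toLinearMap

theorem opA_isSymmetric (S : QModel X Y A B) (i : X × A) : (S.opA i).IsSymmetric :=
  (S.M.pos i.1 i.2).isSymmetric

theorem opB_isSymmetric (S : QModel X Y A B) (i : Y × B) : (S.opB i).IsSymmetric :=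
  (S.N.pos i.1 i.2).isSymmetric

theorem mapL_one_one {H K : Type*} [NormedAddCommGroup H] [InnerProductSpace ℂ H]
    [NormedAddCommGroup K] [InnerProductSpace ℂ K] :
    mapL (1 : H →L[ℂ] H) (1 : K →L[ℂ] K) = 1 := mapL_id_id

theorem state_tmul (S : QModel X Y A B) (a : POVMAlg X A) (b : POVMAlg Y B) :
    S.state.toFun (MinTensor.tmul a b) =
      inner ℂ S.ψ (mapL (POVMAlg.lift S.M a) (POVMAlg.lift S.N b) S.ψ) := by
  change inner ℂ (S.ψ : HilbertTensor S.HA S.HB)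
    (opTensor (POVMAlg.lift S.M a) (POVMAlg.lift S.N b) S.ψ) = _
  rw [opTensor, ContinuousLinearMap.completion_apply_coe, UniformSpace.Completion.inner_coe]

theorem hasCorrelation_state_iff (S : QModel X Y A B) (p : A → B → X → Y → ℝ) :
    HasCorrelation S.state p ↔ S.IsModelFor p := by
  simp only [HasCorrelation, IsModelFor, state_tmul, POVMAlg.lift_gen]

/-- The map `a ⊗ b ↦ (φ_A(a) ⊗ φ_B(b)) ψ` on the algebraic tensor product. -/
def evalTensor (S : QModel X Y A B) :
    POVMAlg X A ⊗[ℂ] POVMAlg Y B →ₗ[ℂ] S.HA ⊗[ℂ] S.HB :=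
  TensorProduct.lift (LinearMap.mk₂ ℂ
    (fun a b => mapL (POVMAlg.lift S.M a) (POVMAlg.lift S.N b) S.ψ)
    (fun _ _ _ => by rw [map_add, mapL_add_left]; rfl)
    (fun _ _ _ => by rw [map_smul, mapL_smul_left]; rfl)
    (fun _ _ _ => by rw [map_add, mapL_add_right]; rfl)
    (fun _ _ _ => by rw [map_smul, mapL_smul_right]; rfl))

theorem evalTensor_tmul (S : QModel X Y A B) (a : POVMAlg X A) (b : POVMAlg Y B) :
    S.evalTensor (a ⊗ₜ b) = mapL (POVMAlg.lift S.M a) (POVMAlg.lift S.N b) S.ψ := rfl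

/-- Moving adjoints across shows that the state alone determines the geometry of the vectors
`(φ_A(a) ⊗ φ_B(b)) ψ`, as in the GNS construction. -/
theorem inner_evalTensor_tmul (S : QModel X Y A B) (a a' : POVMAlg X A) (b b' : POVMAlg Y B) :
    inner ℂ (S.evalTensor (a ⊗ₜ b)) (S.evalTensor (a' ⊗ₜ b')) =
      S.state.toFun (MinTensor.tmul (star a * a') (star b * b')) := by
  have : CompleteSpace (S.HA ⊗[ℂ] S.HB) := FiniteDimensional.complete ℂ _
  rw [state_tmul, evalTensor_tmul, evalTensor_tmul, map_mul, map_mul, mapL_mul, map_star,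
    map_star, ContinuousLinearMap.star_eq_adjoint, ContinuousLinearMap.star_eq_adjoint,
    ← adjoint_mapL, mul_apply_eq_comp, ContinuousLinearMap.adjoint_inner_right]

theorem norm_evalTensor_eq {S T : QModel X Y A B} (h : S.state = T.state)
    (x : POVMAlg X A ⊗[ℂ] POVMAlg Y B) : ‖S.evalTensor x‖ = ‖T.evalTensor x‖ := by
  have key : ∀ x y, inner ℂ (S.evalTensor x) (S.evalTensor y) =
      inner ℂ (T.evalTensor x) (T.evalTensor y) := by
    intro x y
    induction x with
    | zero => simp
    | add x x' hx hx' => simp only [map_add, inner_add_left, hx, hx']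
    | tmul a b =>
      induction y with
      | zero => simp
      | add y y' hy hy' => simp only [map_add, inner_add_right, hy, hy']
      | tmul a' b' => rw [inner_evalTensor_tmul, inner_evalTensor_tmul, h]
  rw [@norm_eq_sqrt_re_inner ℂ, @norm_eq_sqrt_re_inner ℂ, key]

/-- Left multiplication by a generator does not depend on the model, so it matches the operators of
two models with each other. -/
theorem evalTensor_gen_mul_left (S : QModel X Y A B) (i : X × A)
    (x : POVMAlg X A ⊗[ℂ] POVMAlg Y B) :
    S.evalTensor ((LinearMap.mulLeft ℂ (POVMAlg.gen i.1 i.2)).rTensor _ x) =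
      (S.opA i).rTensor _ (S.evalTensor x) := by
  induction x with
  | zero => simp
  | add x y hx hy => simp only [map_add, hx, hy]
  | tmul a b =>
    rw [LinearMap.rTensor_tmul, evalTensor_tmul, evalTensor_tmul, LinearMap.mulLeft_apply,
      map_mul, POVMAlg.lift_gen]
    conv_lhs => rw [← one_mul (POVMAlg.lift S.N b), mapL_mul, mul_apply_eq_comp, mapL_apply]
    rfl

theorem evalTensor_gen_mul_right (S : QModel X Y A B) (i : Y × B)
    (x : POVMAlg X A ⊗[ℂ] POVMAlg Y B) :
    S.evalTensor ((LinearMap.mulLeft ℂ (POVMAlg.gen i.1 i.2)).lTensor _ x) =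
      (S.opB i).lTensor _ (S.evalTensor x) := by
  induction x with
  | zero => simp
  | add x y hx hy => simp only [map_add, hx, hy]
  | tmul a b =>
    rw [LinearMap.lTensor_tmul, evalTensor_tmul, evalTensor_tmul, LinearMap.mulLeft_apply,
      map_mul, POVMAlg.lift_gen]
    conv_lhs => rw [← one_mul (POVMAlg.lift S.M a), mapL_mul, mul_apply_eq_comp, mapL_apply]
    rfl

theorem isSymmetric_rTensor {V W : Type*} [NormedAddCommGroup V] [InnerProductSpace ℂ V]
    [NormedAddCommGroup W] [InnerProductSpace ℂ W] [FiniteDimensional ℂ V]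
    [FiniteDimensional ℂ W] {m : V →ₗ[ℂ] V} (hm : m.IsSymmetric) :
    (m.rTensor W).IsSymmetric := by
  rw [LinearMap.isSymmetric_iff_isSelfAdjoint, LinearMap.isSelfAdjoint_iff'] at hm ⊢
  rw [LinearMap.adjoint_rTensor, hm]

theorem isSymmetric_lTensor {V W : Type*} [NormedAddCommGroup V] [InnerProductSpace ℂ V]
    [NormedAddCommGroup W] [InnerProductSpace ℂ W] [FiniteDimensional ℂ V]
    [FiniteDimensional ℂ W] {m : V →ₗ[ℂ] V} (hm : m.IsSymmetric) :
    (m.lTensor W).IsSymmetric := by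
  rw [LinearMap.isSymmetric_iff_isSelfAdjoint, LinearMap.isSelfAdjoint_iff'] at hm ⊢
  rw [LinearMap.adjoint_lTensor, hm]

/-- A linear map sending `Φ d` to `Ψ d` and vanishing on the complement of the range of `Φ`
intertwines symmetric operators that correspond to each other on the two ranges. -/
theorem comp_eq_comp_of_range {D E F : Type*} [AddCommGroup D] [Module ℂ D]
    [NormedAddCommGroup E] [InnerProductSpace ℂ E] [FiniteDimensional ℂ E]
    [AddCommGroup F] [Module ℂ F] {Φ : D →ₗ[ℂ] E} {Ψ : D →ₗ[ℂ] F} {J : E →ₗ[ℂ] F}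
    (hJ : ∀ d, J (Φ d) = Ψ d) (hJ0 : ∀ z ∈ (LinearMap.range Φ)ᗮ, J z = 0)
    {g : D →ₗ[ℂ] D} {m : E →ₗ[ℂ] E} {n : F →ₗ[ℂ] F} (hm : m.IsSymmetric)
    (hΦ : ∀ d, Φ (g d) = m (Φ d)) (hΨ : ∀ d, Ψ (g d) = n (Ψ d)) : J ∘ₗ m = n ∘ₗ J := by
  ext z
  have hinv : ∀ v ∈ LinearMap.range Φ, m v ∈ LinearMap.range Φ := by
    rintro _ ⟨d, rfl⟩
    exact ⟨g d, hΦ d⟩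
  rw [← (LinearMap.range Φ).starProjection_add_starProjection_orthogonal z]
  obtain ⟨d, hd⟩ := (LinearMap.range Φ).starProjection_apply_mem z
  have hz := (LinearMap.range Φ)ᗮ.starProjection_apply_mem z
  rw [← hd]
  simp only [LinearMap.comp_apply, map_add, hJ0 _ hz,
    hJ0 _ (orthogonal_invariant hm hinv _ hz), ← hΦ, hJ, hΨ, map_zero]

/-- Uniqueness in the GNS construction. The vector of `T` need not be cyclic: `J` vanishes on the
complement of the cyclic subspace, which is invariant because the operators are symmetric. -/
theorem exists_intertwiner_of_state_eq {S T : QModel X Y A B} (h : S.state = T.state) :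
    ∃ J : T.HA ⊗[ℂ] T.HB →ₗ[ℂ] S.HA ⊗[ℂ] S.HB, J T.ψ = S.ψ ∧
      (∀ i, J ∘ₗ (T.opA i).rTensor _ = (S.opA i).rTensor _ ∘ₗ J) ∧
      (∀ i, J ∘ₗ (T.opB i).lTensor _ = (S.opB i).lTensor _ ∘ₗ J) := by
  obtain ⟨J, hJ, hJ0⟩ := exists_linearMap_of_norm_eq T.evalTensor S.evalTensor
    fun x => (norm_evalTensor_eq h x).symm
  have h1 : ∀ S : QModel X Y A B, S.evalTensor (1 ⊗ₜ 1) = S.ψ := fun S => by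
    rw [evalTensor_tmul, map_one, map_one, mapL_one_one, one_apply_eq_self]
  refine ⟨J, ?_, fun i => ?_, fun i => ?_⟩
  · rw [← h1, hJ, h1]
  · exact comp_eq_comp_of_range hJ hJ0 (isSymmetric_rTensor (T.opA_isSymmetric i))
      (T.evalTensor_gen_mul_left i) (S.evalTensor_gen_mul_left i)
  · exact comp_eq_comp_of_range hJ hJ0 (isSymmetric_lTensor (T.opB_isSymmetric i))
      (T.evalTensor_gen_mul_right i) (S.evalTensor_gen_mul_right i)

theorem mapL_op_apply (S : QModel X Y A B) (a : A) (b : B) (x : X) (y : Y)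
    (z : S.HA ⊗[ℂ] S.HB) : mapL (S.M.op x a) (S.N.op y b) z =
      (S.opA (x, a)).rTensor _ ((S.opB (y, b)).lTensor _ z) := by
  rw [← LinearMap.comp_apply, LinearMap.rTensor_comp_lTensor, mapL_apply]
  rfl

theorem locallyDilatesTo_of_irreducible [Fintype X] [Fintype Y]
    {S T : QModel X Y A B} (hA : IsIrreducibleFamily T.opA) (hB : IsIrreducibleFamily T.opB)
    (h : S.state = T.state) : S.LocallyDilatesTo T := by
  obtain ⟨J, hJψ, hJA, hJB⟩ := exists_intertwiner_of_state_eq h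
  obtain ⟨x, rfl⟩ := exists_tensor_of_intertwines J hJA hJB
  obtain ⟨v₀, hv₀⟩ : ∃ v : T.HA, ‖v‖ = 1 := exists_norm_eq _ zero_le_one
  obtain ⟨w₀, hw₀⟩ : ∃ w : T.HB, ‖w‖ = 1 := exists_norm_eq _ zero_le_one
  obtain ⟨IA, hIA⟩ := exists_isometry_of_irreducible T.opA_isSymmetric S.opA_isSymmetric hA hv₀
  obtain ⟨IB, hIB⟩ := exists_isometry_of_irreducible T.opB_isSymmetric S.opB_isSymmetric hB hw₀
  -- With `J = ∑ s ⊗ t`, this is `∑ s v₀ ⊗ t w₀`, the second legs left by the two isometries.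
  let aux : S.HA ⊗[ℂ] S.HB :=
    TensorProduct.map (LinearMap.applyₗ v₀ ∘ₗ (intertwiners T.opA S.opA).subtype)
      (LinearMap.applyₗ w₀ ∘ₗ (intertwiners T.opB S.opB).subtype) x
  have key : ∀ (x : intertwiners T.opA S.opA ⊗[ℂ] intertwiners T.opB S.opB)
      (z : T.HA ⊗[ℂ] T.HB), TensorProduct.map IA.toLinearMap IB.toLinearMap
        (homTensorHomMap (RingHom.id ℂ) T.HA T.HB S.HA S.HB
          (TensorProduct.map (intertwiners T.opA S.opA).subtype
          (intertwiners T.opB S.opB).subtype x) z) =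
      tensorTensorTensorComm ℂ T.HA T.HB S.HA S.HB (z ⊗ₜ
        TensorProduct.map (LinearMap.applyₗ v₀ ∘ₗ (intertwiners T.opA S.opA).subtype)
          (LinearMap.applyₗ w₀ ∘ₗ (intertwiners T.opB S.opB).subtype) x) := by
    intro x z
    induction x with
    | zero => simp
    | add x x' hx hx' => simp only [map_add, LinearMap.add_apply, hx, hx', tmul_add]
    | tmul s t =>
      induction z with
      | zero => simp
      | add z z' hz hz' => simp only [map_add, hz, hz', add_tmul]
      | tmul v w => simp [hIA _ s.2, hIB _ t.2]
  -- The isometries preserve norms and `J` maps the unit vector of `T` to that of `S`, so `aux` must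
  -- be a unit vector.
  have hnorm : ‖aux‖ = 1 := by
    have h1 := congrArg norm (key x T.ψ)
    rwa [hJψ, TensorProduct.norm_map, norm_tensorTensorTensorComm, S.norm_ψ,
      T.norm_ψ, one_mul, eq_comm] at h1
  refine ⟨S.HA, S.HB, inferInstance, inferInstance, inferInstance, inferInstance, inferInstance,
    inferInstance, aux, IA, IB, hnorm, fun a b x' y' => ?_⟩
  rw [← key, mapL_op_apply, mapL_op_apply]
  congr 1
  -- Both operators of `S` are pulled through `J`, where they become those of `T`.
  rw [← hJψ, ← LinearMap.comp_apply (LinearMap.lTensor _ _), ← hJB, LinearMap.comp_apply,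
    ← LinearMap.comp_apply, ← hJA, LinearMap.comp_apply]

/-! ### Extremality, submodels and minimal models -/

theorem isSymmetric_map {H K : Type*} [NormedAddCommGroup H] [InnerProductSpace ℂ H]
    [NormedAddCommGroup K] [InnerProductSpace ℂ K] [FiniteDimensional ℂ H]
    [FiniteDimensional ℂ K] {m : H →ₗ[ℂ] H} {n : K →ₗ[ℂ] K} (hm : m.IsSymmetric)
    (hn : n.IsSymmetric) : (TensorProduct.map m n).IsSymmetric := by
  rw [LinearMap.isSymmetric_iff_isSelfAdjoint, LinearMap.isSelfAdjoint_iff'] at *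
  rw [adjoint_map, hm, hn]

theorem mapL_op_eq_map (S : QModel X Y A B) (a : A) (b : B) (x : X) (y : Y)
    (z : S.HA ⊗[ℂ] S.HB) : mapL (S.M.op x a) (S.N.op y b) z =
      TensorProduct.map (S.opA (x, a)) (S.opB (y, b)) z := by
  rw [mapL_apply]
  rfl

/-- The unnormalised correlation `⟨ξ| M^x_a ⊗ N^y_b |ξ⟩` of a vector. -/
def vectorCorrelation (S : QModel X Y A B) (ξ : S.HA ⊗[ℂ] S.HB) (a : A) (b : B) (x : X)
    (y : Y) : ℝ :=
  (inner ℂ ξ (TensorProduct.map (S.opA (x, a)) (S.opB (y, b)) ξ)).re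

theorem coe_vectorCorrelation (S : QModel X Y A B) (ξ : S.HA ⊗[ℂ] S.HB) (a : A) (b : B)
    (x : X) (y : Y) : (S.vectorCorrelation ξ a b x y : ℂ) =
      inner ℂ ξ (TensorProduct.map (S.opA (x, a)) (S.opB (y, b)) ξ) := by
  have h := isSymmetric_map (S.opA_isSymmetric (x, a)) (S.opB_isSymmetric (y, b)) ξ ξ
  rw [← inner_conj_symm] at h
  exact Complex.conj_eq_iff_re.1 h

theorem isModelFor_iff (S : QModel X Y A B) (p : A → B → X → Y → ℝ) :
    S.IsModelFor p ↔ S.vectorCorrelation S.ψ = p := by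
  simp only [IsModelFor, mapL_op_eq_map, ← coe_vectorCorrelation, Complex.ofReal_inj, funext_iff]

theorem vectorCorrelation_smul (S : QModel X Y A B) (c : ℝ) (ξ : S.HA ⊗[ℂ] S.HB) :
    S.vectorCorrelation ((c : ℂ) • ξ) = c ^ 2 • S.vectorCorrelation ξ := by
  ext a b x y
  apply Complex.ofReal_injective
  simp only [coe_vectorCorrelation, Pi.smul_apply, smul_eq_mul, Complex.ofReal_mul, map_smul,
    inner_smul_tensor, inner_tensor_smul, Complex.conj_ofReal]
  push_cast
  ring

/-- The model with the same operators and another vector. -/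
def withVector (S : QModel X Y A B) (ξ : S.HA ⊗[ℂ] S.HB) (hξ : ‖ξ‖ = 1) : QModel X Y A B where
  HA := S.HA
  HB := S.HB
  M := S.M
  N := S.N
  ψ := ξ
  norm_ψ := hξ

theorem norm_inv_norm_smul {E : Type*} [NormedAddCommGroup E] [InnerProductSpace ℂ E] {ξ : E}
    (hξ : ξ ≠ 0) : ‖((‖ξ‖⁻¹ : ℝ) : ℂ) • ξ‖ = 1 := by
  have h := norm_ne_zero_iff.2 hξ
  rw [norm_smul, Complex.norm_real, norm_inv, norm_norm, inv_mul_cancel₀ h]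

theorem smul_vectorCorrelation_mem_Cq (S : QModel X Y A B) {ξ : S.HA ⊗[ℂ] S.HB} (hξ : ξ ≠ 0) :
    (‖ξ‖⁻¹ ^ 2 • S.vectorCorrelation ξ) ∈ Cq X Y A B := by
  refine ⟨S.withVector _ (norm_inv_norm_smul hξ), ?_⟩
  rw [isModelFor_iff, ← vectorCorrelation_smul]
  rfl

theorem norm_sq_add_norm_sub_sq {E : Type*} [NormedAddCommGroup E] [InnerProductSpace ℂ E]
    {R : E →ₗ[ℂ] E} (hR : R.IsSymmetric) (hRR : R ∘ₗ R = R) (z : E) :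
    ‖R z‖ ^ 2 + ‖z - R z‖ ^ 2 = ‖z‖ ^ 2 := by
  have h1 : inner ℂ (R z) (z - R z) = 0 := by
    rw [hR, map_sub, ← LinearMap.comp_apply, hRR, sub_self, inner_zero_right]
  have h2 := norm_add_sq_eq_norm_sq_add_norm_sq_of_inner_eq_zero _ _ h1
  rw [add_sub_cancel] at h2
  linarith

/-- `R` is a projection commuting with the measurement operators, so the cross terms between `R ψ`
and `ψ - R ψ` vanish. Thus `p` is a convex combination, with weights the squared norms, of the
correlations of the two normalised parts. -/
theorem vectorCorrelation_of_extreme {p : A → B → X → Y → ℝ}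
    (hp : p ∈ (Cq X Y A B).extremePoints ℝ) {S : QModel X Y A B} (hS : S.IsModelFor p)
    {R : S.HA ⊗[ℂ] S.HB →ₗ[ℂ] S.HA ⊗[ℂ] S.HB} (hR : R.IsSymmetric) (hRR : R ∘ₗ R = R)
    (hcomm : ∀ a b x y, R ∘ₗ TensorProduct.map (S.opA (x, a)) (S.opB (y, b)) =
      TensorProduct.map (S.opA (x, a)) (S.opB (y, b)) ∘ₗ R) (hne : R S.ψ ≠ 0) :
    ‖R S.ψ‖⁻¹ ^ 2 • S.vectorCorrelation (R S.ψ) = p := by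
  have hRR' : ∀ z, R (R z) = R z := LinearMap.congr_fun hRR
  have h0 : R (S.ψ - R S.ψ) = 0 := by rw [map_sub, hRR', sub_self]
  have hdecomp : S.ψ = R S.ψ + (S.ψ - R S.ψ) := by abel
  have hnorm : ‖R S.ψ‖ ^ 2 + ‖S.ψ - R S.ψ‖ ^ 2 = 1 := by
    have h := norm_sq_add_norm_sub_sq hR hRR S.ψ
    rwa [S.norm_ψ, one_pow] at h
  have hcorr : p = S.vectorCorrelation (R S.ψ) + S.vectorCorrelation (S.ψ - R S.ψ) := by
    rw [← (S.isModelFor_iff p).1 hS]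
    ext a b x y
    apply Complex.ofReal_injective
    simp only [Pi.add_apply, Complex.ofReal_add, coe_vectorCorrelation]
    set Z := TensorProduct.map (S.opA (x, a)) (S.opB (y, b))
    have hZ : ∀ z, R (Z z) = Z (R z) := LinearMap.congr_fun (hcomm a b x y)
    have h1 : inner ℂ (R S.ψ) (Z (S.ψ - R S.ψ)) = 0 := by
      rw [hR, hZ, h0, map_zero, inner_zero_right]
    have h2 : inner ℂ (S.ψ - R S.ψ) (Z (R S.ψ)) = 0 := by
      rw [← hZ, ← hR, h0, inner_zero_left]
    conv_lhs => rw [hdecomp]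
    rw [map_add, inner_add_left, inner_add_right, inner_add_right, h1, h2, add_zero, zero_add]
  -- If the second part vanishes it cannot be normalised, but then `R` fixes `ψ`.
  by_cases h2 : S.ψ - R S.ψ = 0
  · have h3 : R S.ψ = S.ψ := (sub_eq_zero.1 h2).symm
    rw [h3, S.norm_ψ, (S.isModelFor_iff p).1 hS]
    simp
  · have hp1 := norm_pos_iff.2 hne
    have hp2 := norm_pos_iff.2 h2
    refine hp.2 (S.smul_vectorCorrelation_mem_Cq hne) (S.smul_vectorCorrelation_mem_Cq h2)
      ⟨‖R S.ψ‖ ^ 2, ‖S.ψ - R S.ψ‖ ^ 2, by positivity, by positivity, hnorm, ?_⟩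
    rw [smul_smul, smul_smul, ← mul_pow, ← mul_pow, mul_inv_cancel₀ hp1.ne',
      mul_inv_cancel₀ hp2.ne', one_pow, one_smul, one_smul, ← hcorr]

theorem locallyEquivalent_refl (S : QModel X Y A B) : S.LocallyEquivalent S := by
  refine ⟨LinearIsometryEquiv.refl ℂ _, LinearIsometryEquiv.refl ℂ _, ?_, fun _ _ _ => rfl,
    fun _ _ _ => rfl⟩
  exact LinearMap.congr_fun TensorProduct.map_id S.ψ

/-- The submodel carries the normalised vector `(Π_A ⊗ Π_B) ψ`. Closedness keeps it in the class and
extremality keeps its correlation equal to `p`. -/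
theorem exists_submodel {p : A → B → X → Y → ℝ} (hp : p ∈ (Cq X Y A B).extremePoints ℝ)
    {𝒞 : Set (QModel X Y A B)} (h𝒞 : IsClosedClass 𝒞) {S : QModel X Y A B} (hS𝒞 : S ∈ 𝒞)
    (hS : S.IsModelFor p) {VA : Submodule ℂ S.HA} {VB : Submodule ℂ S.HB}
    (hA : ∀ i, ∀ v ∈ VA, S.opA i v ∈ VA) (hB : ∀ i, ∀ v ∈ VB, S.opB i v ∈ VB)
    (hne : TensorProduct.map VA.starProjection.toLinearMap VB.starProjection.toLinearMap S.ψ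
      ≠ 0) :
    ∃ T ∈ 𝒞, T.IsModelFor p ∧ Module.finrank ℂ T.HA = Module.finrank ℂ VA ∧
      Module.finrank ℂ T.HB = Module.finrank ℂ VB := by
  have hcA : ∀ i v, VA.starProjection (S.opA i v) = S.opA i (VA.starProjection v) := fun i =>
    starProjection_apply_of_invariant (S.opA_isSymmetric i) (hA i)
  have hcB : ∀ i v, VB.starProjection (S.opB i v) = S.opB i (VB.starProjection v) := fun i =>
    starProjection_apply_of_invariant (S.opB_isSymmetric i) (hB i)
  set R := TensorProduct.map VA.starProjection.toLinearMap VB.starProjection.toLinearMap with hRd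
  have hR : R.IsSymmetric := isSymmetric_map VA.starProjection_isSymmetric
    VB.starProjection_isSymmetric
  have hRR : R ∘ₗ R = R := by
    ext v w
    simp [hRd, Submodule.starProjection_eq_self_iff.2 (Submodule.starProjection_apply_mem _ _)]
  have hcomm : ∀ a b x y, R ∘ₗ TensorProduct.map (S.opA (x, a)) (S.opB (y, b)) =
      TensorProduct.map (S.opA (x, a)) (S.opB (y, b)) ∘ₗ R := by
    intro a b x y
    ext v w
    simp [hRd, hcA, hcB]
  have hext := vectorCorrelation_of_extreme hp hS hR hRR hcomm hne
  let φ := TensorProduct.map VA.orthogonalProjectionOnto.toLinearMap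
    VB.orthogonalProjectionOnto.toLinearMap S.ψ
  have hφ : TensorProduct.map VA.subtype VB.subtype φ = R S.ψ := by
    rw [← LinearMap.comp_apply, ← TensorProduct.map_comp]
    rfl
  have hφn : ‖φ‖ = ‖R S.ψ‖ := by
    rw [← hφ]
    exact (TensorProduct.norm_map VA.subtypeₗᵢ VB.subtypeₗᵢ φ).symm
  have hφ0 : φ ≠ 0 := fun h => hne (by rw [← hφ, h, map_zero])
  let T := S.compress VA VB _ (norm_inv_norm_smul hφ0)
  have hT : T.IsSubmodelOf S := by
    refine ⟨VA, VB, _, norm_inv_norm_smul hφ0, rfl, ⟨(‖φ‖ : ℝ), ?_, ?_⟩, fun x a => ?_,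
      fun y b => ?_⟩
    · exact_mod_cast norm_ne_zero_iff.2 hφ0
    · rw [map_smul, smul_smul, ← Complex.ofReal_mul, mul_inv_cancel₀ (norm_ne_zero_iff.2 hφ0),
        Complex.ofReal_one, one_smul, hφ, mapL_apply]
    · ext v
      exact hcA (x, a) v
    · ext v
      exact hcB (y, b) v
  refine ⟨T, h𝒞 S hS𝒞 T T hT T.locallyEquivalent_refl, ?_, rfl, rfl⟩
  rw [isModelFor_iff, ← hext, ← vectorCorrelation_smul]
  ext a b x y
  apply Complex.ofReal_injective
  rw [coe_vectorCorrelation, coe_vectorCorrelation, ← hφn, ← hφ, ← map_smul]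
  -- On invariant subspaces compression is restriction.
  have hop : ∀ z : VA ⊗[ℂ] VB, TensorProduct.map (S.opA (x, a)) (S.opB (y, b))
        (TensorProduct.map VA.subtype VB.subtype z) =
      TensorProduct.map VA.subtype VB.subtype (TensorProduct.map
        ((S.M.compress VA).op x a).toLinearMap ((S.N.compress VB).op y b).toLinearMap z) := by
    intro z
    induction z with
    | zero => simp
    | add z z' hz hz' => simp only [map_add, hz, hz']
    | tmul v w =>
      simp only [TensorProduct.map_tmul]
      congr 1
      · exact (Submodule.starProjection_eq_self_iff.2 (hA (x, a) _ v.2)).symm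
      · exact (Submodule.starProjection_eq_self_iff.2 (hB (y, b) _ w.2)).symm
  rw [hop]
  exact (TensorProduct.inner_map_map VA.subtypeₗᵢ VB.subtypeₗᵢ _ _).symm

/-- In a model of least total dimension, invariant subspaces whose projections do not kill the
vector are everything. For an invariant `E`, the projections to `E` and `Eᗮ` cannot both kill `ψ`,
their sum being the identity; so `E` or `Eᗮ` is the whole space. -/
theorem exists_irreducible_model {p : A → B → X → Y → ℝ}
    (hp : p ∈ (Cq X Y A B).extremePoints ℝ) {𝒞 : Set (QModel X Y A B)} (h𝒞 : IsClosedClass 𝒞)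
    (hex : ∃ S ∈ 𝒞, S.IsModelFor p) :
    ∃ T ∈ 𝒞, T.IsModelFor p ∧ IsIrreducibleFamily T.opA ∧ IsIrreducibleFamily T.opB := by
  let d : QModel X Y A B → ℕ := fun S => Module.finrank ℂ S.HA + Module.finrank ℂ S.HB
  obtain ⟨T, ⟨hT𝒞, hT⟩, hmin⟩ := WellFounded.has_min (measure d).wf
    {S | S ∈ 𝒞 ∧ S.IsModelFor p} hex
  have hmin' : ∀ (VA : Submodule ℂ T.HA) (VB : Submodule ℂ T.HB),
      (∀ i, ∀ v ∈ VA, T.opA i v ∈ VA) → (∀ i, ∀ v ∈ VB, T.opB i v ∈ VB) →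
      TensorProduct.map VA.starProjection.toLinearMap VB.starProjection.toLinearMap T.ψ ≠ 0 →
      VA = ⊤ ∧ VB = ⊤ := by
    intro VA VB hA hB hne
    obtain ⟨T', hT'𝒞, hT', h1, h2⟩ := exists_submodel hp h𝒞 hT𝒞 hT hA hB hne
    have h3 : ¬ d T' < d T := hmin T' ⟨hT'𝒞, hT'⟩
    have h4 := Submodule.finrank_le VA
    have h5 := Submodule.finrank_le VB
    simp only [d, h1, h2] at h3
    exact ⟨Submodule.eq_top_of_finrank_eq (by omega), Submodule.eq_top_of_finrank_eq (by omega)⟩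
  have hψ : T.ψ ≠ 0 := by
    rw [← norm_ne_zero_iff, T.norm_ψ]
    exact one_ne_zero
  refine ⟨T, hT𝒞, hT, fun E hE => ?_, fun E hE => ?_⟩
  · by_cases h : TensorProduct.map E.starProjection.toLinearMap
      (⊤ : Submodule ℂ T.HB).starProjection.toLinearMap T.ψ = 0
    · left
      rw [← Submodule.orthogonal_eq_top_iff]
      refine (hmin' Eᗮ ⊤ (fun i => orthogonal_invariant (T.opA_isSymmetric i) (hE i))
        (fun _ _ _ => trivial) fun h' => hψ ?_).1
      have h3 := congrArg₂ (· + ·) h h'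
      simp only [← LinearMap.add_apply, ← TensorProduct.map_add_left, add_zero] at h3
      rw [← h3, ← ContinuousLinearMap.toLinearMap_add,
        Submodule.starProjection_orthogonal', add_sub_cancel, Submodule.starProjection_top']
      exact (LinearMap.congr_fun TensorProduct.map_id T.ψ).symm
    · exact Or.inr (hmin' E ⊤ hE (fun _ _ _ => trivial) h).1
  · by_cases h : TensorProduct.map (⊤ : Submodule ℂ T.HA).starProjection.toLinearMap
      E.starProjection.toLinearMap T.ψ = 0
    · left
      rw [← Submodule.orthogonal_eq_top_iff]
      refine (hmin' ⊤ Eᗮ (fun _ _ _ => trivial)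
        (fun i => orthogonal_invariant (T.opB_isSymmetric i) (hE i)) fun h' => hψ ?_).2
      have h3 := congrArg₂ (· + ·) h h'
      simp only [← LinearMap.add_apply, ← TensorProduct.map_add_right, add_zero] at h3
      rw [← h3, ← ContinuousLinearMap.toLinearMap_add,
        Submodule.starProjection_orthogonal', add_sub_cancel, Submodule.starProjection_top']
      exact (LinearMap.congr_fun TensorProduct.map_id T.ψ).symm
    · exact Or.inr (hmin' ⊤ E (fun _ _ _ => trivial) hE h).2

theorem isSelfTest_of_isAbstractStateSelfTest [Fintype X] [Fintype Y]
    {p : A → B → X → Y → ℝ} (hp : p ∈ (Cq X Y A B).extremePoints ℝ)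
    {𝒞 : Set (QModel X Y A B)} (h𝒞 : IsClosedClass 𝒞)
    (h : IsAbstractStateSelfTest p {f | ∃ S ∈ 𝒞, S.state = f}) : IsSelfTest p 𝒞 := by
  obtain ⟨f, ⟨⟨S, hS𝒞, rfl⟩, hS⟩, huniq⟩ := h
  obtain ⟨T, hT𝒞, hT, hTA, hTB⟩ := exists_irreducible_model hp h𝒞
    ⟨S, hS𝒞, (S.hasCorrelation_state_iff p).1 hS⟩
  refine ⟨T, hT𝒞, hT, fun S' hS'𝒞 hS' => locallyDilatesTo_of_irreducible hTA hTB ?_⟩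
  rw [huniq S'.state ⟨⟨S', hS'𝒞, rfl⟩, (S'.hasCorrelation_state_iff p).2 hS'⟩,
    huniq T.state ⟨⟨T, hT𝒞, rfl⟩, (T.hasCorrelation_state_iff p).2 hT⟩]

end QModel

/-! ### The left support of a tensor -/

section Support

open TensorProduct

variable {V W H K H' K' : Type*}
  [AddCommGroup V] [Module ℂ V] [AddCommGroup W] [Module ℂ W]
  [AddCommGroup H] [Module ℂ H] [AddCommGroup K] [Module ℂ K]
  [AddCommGroup H'] [Module ℂ H'] [AddCommGroup K'] [Module ℂ K']

/-- The slice `(1 ⊗ f) ψ` of a tensor, as a function of `ψ` and `f`. -/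
def slice : H ⊗[ℂ] K →ₗ[ℂ] Module.Dual ℂ K →ₗ[ℂ] H :=
  TensorProduct.lift (LinearMap.mk₂ ℂ
    (fun h k => (LinearMap.toSpanSingleton ℂ H h) ∘ₗ (Module.Dual.eval ℂ K k))
    (fun h h' k => by ext; simp) (fun c h k => by ext; simp [smul_smul, mul_comm])
    (fun h k k' => by ext; simp [add_smul]) (fun c h k => by ext; simp [smul_smul]))

theorem slice_tmul (h : H) (k : K) (f : Module.Dual ℂ K) : slice (h ⊗ₜ[ℂ] k) f = f k • h := rfl

/-- The smallest subspace `E` of `H` with `ψ ∈ E ⊗ K`. -/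
def leftSupport (ψ : H ⊗[ℂ] K) : Submodule ℂ H := LinearMap.range (slice ψ)

theorem slice_mem_leftSupport (ψ : H ⊗[ℂ] K) (f : Module.Dual ℂ K) :
    slice ψ f ∈ leftSupport ψ := ⟨f, rfl⟩

theorem slice_map (g : H →ₗ[ℂ] H') (h : K →ₗ[ℂ] K') (ψ : H ⊗[ℂ] K) (f : Module.Dual ℂ K') :
    slice (TensorProduct.map g h ψ) f = g (slice ψ (f ∘ₗ h)) := by
  induction ψ with
  | zero => simp
  | add z z' hz hz' => simp only [map_add, LinearMap.add_apply, hz, hz']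
  | tmul u v => simp [slice_tmul]

/-- The coordinates of a tensor in a basis of `K` are slices. -/
theorem eq_zero_of_slice_eq_zero {ψ : H ⊗[ℂ] K} (h : ∀ f, slice ψ f = 0) : ψ = 0 := by
  classical
  let b := Module.Basis.ofVectorSpace ℂ K
  have key : ∀ (ψ : H ⊗[ℂ] K) i,
      TensorProduct.equivFinsuppOfBasisRight b ψ i = slice ψ (b.coord i) := by
    intro ψ i
    induction ψ with
    | zero => simp
    | add z z' hz hz' => simp only [map_add, Finsupp.add_apply, LinearMap.add_apply, hz, hz']
    | tmul u v => simp [slice_tmul]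
  refine (TensorProduct.equivFinsuppOfBasisRight b).injective ?_
  ext i
  rw [key, h, map_zero, Finsupp.zero_apply]

theorem map_congr_of_eqOn_leftSupport {ψ : H ⊗[ℂ] K} {g g' : H →ₗ[ℂ] H'}
    (h : ∀ v ∈ leftSupport ψ, g v = g' v) (k : K →ₗ[ℂ] K') :
    TensorProduct.map g k ψ = TensorProduct.map g' k ψ := by
  rw [← sub_eq_zero]
  refine eq_zero_of_slice_eq_zero fun f => ?_
  rw [map_sub, LinearMap.sub_apply, slice_map, slice_map, h _ (slice_mem_leftSupport _ _),
    sub_self]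

/-- As `k` has a left inverse, every functional on `K` factors through `k`, so every slice of `ψ`
can be recovered after `k` is applied. -/
theorem eqOn_leftSupport_of_map_eq {ψ : H ⊗[ℂ] K} {g g' : H →ₗ[ℂ] H'} {k : K →ₗ[ℂ] K'}
    (hk : Function.Injective k) (h : TensorProduct.map g k ψ = TensorProduct.map g' k ψ) :
    ∀ v ∈ leftSupport ψ, g v = g' v := by
  obtain ⟨l, hl⟩ := k.exists_leftInverse_of_injective (LinearMap.ker_eq_bot.2 hk)
  rintro _ ⟨f, rfl⟩
  have hf : (f ∘ₗ l) ∘ₗ k = f := by rw [LinearMap.comp_assoc, hl, LinearMap.comp_id]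
  have h1 := slice_map g k ψ (f ∘ₗ l)
  have h2 := slice_map g' k ψ (f ∘ₗ l)
  rw [hf] at h1 h2
  rw [← h1, ← h2, h]

theorem leftSupport_map {g : H →ₗ[ℂ] H'} {k : K →ₗ[ℂ] K'} (hk : Function.Injective k)
    (ψ : H ⊗[ℂ] K) :
    leftSupport (TensorProduct.map g k ψ) = (leftSupport ψ).map g := by
  obtain ⟨l, hl⟩ := k.exists_leftInverse_of_injective (LinearMap.ker_eq_bot.2 hk)
  apply le_antisymm
  · rintro _ ⟨f, rfl⟩
    rw [slice_map]
    exact ⟨_, slice_mem_leftSupport _ _, rfl⟩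
  · rintro _ ⟨_, ⟨f, rfl⟩, rfl⟩
    refine ⟨f ∘ₗ l, ?_⟩
    rw [slice_map, LinearMap.comp_assoc, hl, LinearMap.comp_id]

theorem slice_tensorTensorTensorComm (φ : V ⊗[ℂ] W) (aux : H ⊗[ℂ] K) (f : Module.Dual ℂ W)
    (g : Module.Dual ℂ K) :
    slice (tensorTensorTensorComm ℂ V W H K (φ ⊗ₜ aux)) (dualDistrib ℂ W K (f ⊗ₜ g)) =
      slice φ f ⊗ₜ slice aux g := by
  induction φ with
  | zero => simp
  | add z z' hz hz' => simp only [map_add, LinearMap.add_apply, add_tmul, hz, hz']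
  | tmul v w =>
    induction aux with
    | zero => simp
    | add z z' hz hz' => simp only [map_add, LinearMap.add_apply, tmul_add, hz, hz']
    | tmul h k =>
      simp only [tensorTensorTensorComm_tmul, slice_tmul, dualDistrib_apply, smul_tmul_smul]

/-- In finite dimension the functionals on `W ⊗ K` are sums of products, and a product functional
slices the two tensors separately. -/
theorem leftSupport_tensorTensorTensorComm [FiniteDimensional ℂ W] [FiniteDimensional ℂ K]
    (φ : V ⊗[ℂ] W) (aux : H ⊗[ℂ] K) :
    leftSupport (tensorTensorTensorComm ℂ V W H K (φ ⊗ₜ aux)) =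
      Submodule.map₂ (TensorProduct.mk ℂ V H) (leftSupport φ) (leftSupport aux) := by
  apply le_antisymm
  · rintro _ ⟨F, rfl⟩
    obtain ⟨F, rfl⟩ := (dualDistribEquiv ℂ W K).surjective F
    change slice _ (dualDistrib ℂ W K F) ∈ _
    induction F with
    | zero => simp
    | add F F' hF hF' => rw [map_add, map_add]; exact add_mem hF hF'
    | tmul f g =>
      rw [slice_tensorTensorTensorComm]
      exact Submodule.apply_mem_map₂ _ (slice_mem_leftSupport _ _) (slice_mem_leftSupport _ _)
  · rw [Submodule.map₂_le]
    rintro _ ⟨f, rfl⟩ _ ⟨g, rfl⟩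
    rw [TensorProduct.mk_apply, ← slice_tensorTensorTensorComm]
    exact slice_mem_leftSupport _ _

theorem map_rTensor_tensorTensorTensorComm (m : V →ₗ[ℂ] V) (n : W →ₗ[ℂ] W) (φ : V ⊗[ℂ] W)
    (aux : H ⊗[ℂ] K) :
    TensorProduct.map (m.rTensor H) (n.rTensor K)
        (tensorTensorTensorComm ℂ V W H K (φ ⊗ₜ aux)) =
      tensorTensorTensorComm ℂ V W H K (TensorProduct.map m n φ ⊗ₜ aux) := by
  induction φ with
  | zero => simp
  | add z z' hz hz' => simp only [map_add, add_tmul, hz, hz']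
  | tmul v w =>
    induction aux with
    | zero => simp
    | add z z' hz hz' => simp only [map_add, tmul_add, hz, hz']
    | tmul h k => simp

theorem comm_tensorTensorTensorComm (φ : V ⊗[ℂ] W) (aux : H ⊗[ℂ] K) :
    TensorProduct.comm ℂ _ _ (tensorTensorTensorComm ℂ V W H K (φ ⊗ₜ aux)) =
      tensorTensorTensorComm ℂ W V K H
        (TensorProduct.comm ℂ _ _ φ ⊗ₜ TensorProduct.comm ℂ _ _ aux) := by
  induction φ with
  | zero => simp
  | add z z' hz hz' => simp only [map_add, add_tmul, hz, hz']
  | tmul v w =>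
    induction aux with
    | zero => simp
    | add z z' hz hz' => simp only [map_add, tmul_add, hz, hz']
    | tmul h k => simp

/-! ### Supports under a dilation -/

section Dilation

variable {ψ : H ⊗[ℂ] K} {φ : V ⊗[ℂ] W} {aux : H' ⊗[ℂ] K'} {IA : H →ₗ[ℂ] V ⊗[ℂ] H'}
  {IB : K →ₗ[ℂ] W ⊗[ℂ] K'} {m : H →ₗ[ℂ] H} {n : V →ₗ[ℂ] V}

/-- The two maps agree on `ψ` after tensoring with the injective `IB`, and injectivity lets this be
tested on slices. -/
theorem intertwines_on_leftSupport (hIB : Function.Injective IB)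
    (h1 : TensorProduct.map IA IB ψ = tensorTensorTensorComm ℂ V W H' K' (φ ⊗ₜ aux))
    (h2 : TensorProduct.map IA IB (m.rTensor K ψ) =
      tensorTensorTensorComm ℂ V W H' K' (n.rTensor W φ ⊗ₜ aux)) :
    ∀ v ∈ leftSupport ψ, IA (m v) = n.rTensor H' (IA v) := by
  refine eqOn_leftSupport_of_map_eq (g := IA ∘ₗ m) (g' := n.rTensor H' ∘ₗ IA) hIB ?_
  have h3 := map_rTensor_tensorTensorTensorComm n LinearMap.id φ aux
  rw [← h1, LinearMap.rTensor_id, ← LinearMap.comp_apply, ← TensorProduct.map_comp,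
    LinearMap.id_comp] at h3
  rw [h3]
  refine Eq.trans ?_ h2
  rw [← LinearMap.comp_apply, LinearMap.map_comp_rTensor]

/-- Here the range of `IA` is the product of the supports of `φ` and `aux`, and the intertwining
relation makes it invariant under `n ⊗ 1`. Slicing off a nonzero vector of the support of `aux`
leaves invariance of the support of `φ`. -/
theorem leftSupport_invariant_of_eq_top [FiniteDimensional ℂ W] [FiniteDimensional ℂ K']
    (hIB : Function.Injective IB) (haux : aux ≠ 0) (hψ : leftSupport ψ = ⊤)
    (h1 : TensorProduct.map IA IB ψ = tensorTensorTensorComm ℂ V W H' K' (φ ⊗ₜ aux))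
    (h2 : TensorProduct.map IA IB (m.rTensor K ψ) =
      tensorTensorTensorComm ℂ V W H' K' (n.rTensor W φ ⊗ₜ aux)) :
    ∀ v ∈ leftSupport φ, n v ∈ leftSupport φ := by
  have hint := intertwines_on_leftSupport hIB h1 h2
  have hsupp := leftSupport_map (g := IA) hIB ψ
  rw [h1, leftSupport_tensorTensorTensorComm, hψ] at hsupp
  obtain ⟨g, hg⟩ : ∃ g, slice aux g ≠ 0 := by
    by_contra! h
    exact haux (eq_zero_of_slice_eq_zero h)
  obtain ⟨e, he⟩ := Module.Projective.exists_dual_ne_zero ℂ hg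
  intro v hv
  have hmem : v ⊗ₜ slice aux g ∈ (⊤ : Submodule ℂ H).map IA := by
    rw [← hsupp]
    exact Submodule.apply_mem_map₂ (TensorProduct.mk ℂ V H') hv (slice_mem_leftSupport _ _)
  obtain ⟨h, -, hh⟩ := hmem
  have hmem : n v ⊗ₜ slice aux g ∈ (⊤ : Submodule ℂ H).map IA := by
    refine ⟨m h, trivial, ?_⟩
    rw [hint h (hψ ▸ trivial), hh, LinearMap.rTensor_tmul]
  have hle : Submodule.map₂ (TensorProduct.mk ℂ V H') (leftSupport φ) (leftSupport aux) ≤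
      (leftSupport φ).comap (slice.flip e) := by
    rw [Submodule.map₂_le]
    intro v hv u _
    exact Submodule.smul_mem _ _ hv
  rw [← hsupp] at hmem
  have h3 : e (slice aux g) • n v ∈ leftSupport φ := hle hmem
  exact (Submodule.smul_mem_iff _ he).1 h3

/-- The product of the supports of `φ` and `aux` is invariant under `n ⊗ 1` and is the image of the
support of `ψ`; injectivity of `IA` pulls this back. -/
theorem leftSupport_invariant_of_dilation [FiniteDimensional ℂ W] [FiniteDimensional ℂ K']
    (hIA : Function.Injective IA) (hIB : Function.Injective IB)
    (hφ : ∀ v ∈ leftSupport φ, n v ∈ leftSupport φ)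
    (h1 : TensorProduct.map IA IB ψ = tensorTensorTensorComm ℂ V W H' K' (φ ⊗ₜ aux))
    (h2 : TensorProduct.map IA IB (m.rTensor K ψ) =
      tensorTensorTensorComm ℂ V W H' K' (n.rTensor W φ ⊗ₜ aux)) :
    ∀ v ∈ leftSupport ψ, m v ∈ leftSupport ψ := by
  have hint := intertwines_on_leftSupport hIB h1 h2
  have hsupp := leftSupport_map (g := IA) hIB ψ
  rw [h1, leftSupport_tensorTensorTensorComm] at hsupp
  have hle : Submodule.map₂ (TensorProduct.mk ℂ V H') (leftSupport φ) (leftSupport aux) ≤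
      (Submodule.map₂ (TensorProduct.mk ℂ V H') (leftSupport φ) (leftSupport aux)).comap
        (n.rTensor H') := by
    rw [Submodule.map₂_le]
    intro v hv u hu
    exact Submodule.apply_mem_map₂ (TensorProduct.mk ℂ V H') (hφ v hv) hu
  intro v hv
  have h3 : IA v ∈ (leftSupport ψ).map IA := ⟨v, hv, rfl⟩
  rw [← hsupp] at h3
  have h4 := hle h3
  rw [Submodule.mem_comap, hsupp, ← hint v hv] at h4
  obtain ⟨w, hw, hwv⟩ := h4
  rwa [← hIA hwv]

end Dilation

/-- Slicing a Schmidt decomposition against `β j` gives `c j • α j`, and the `α j` form a basis. -/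
theorem leftSupport_eq_top_of_sum {K : Type*} [NormedAddCommGroup K] [InnerProductSpace ℂ K]
    [FiniteDimensional ℂ H] {k : ℕ} (hk : k = Module.finrank ℂ H) {c : Fin k → ℝ}
    {α : Fin k → H} {β : Fin k → K} (hc : ∀ i, 0 < c i) (hα : LinearIndependent ℂ α)
    (hβ : Orthonormal ℂ β) : leftSupport (∑ i, (c i : ℂ) • (α i ⊗ₜ[ℂ] β i)) = ⊤ := by
  rw [eq_top_iff, ← hα.span_eq_top_of_card_eq_finrank' (by simpa using hk), Submodule.span_le]
  rintro _ ⟨j, rfl⟩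
  have h : slice (∑ i, (c i : ℂ) • (α i ⊗ₜ[ℂ] β i)) (innerₛₗ ℂ (β j)) = (c j : ℂ) • α j := by
    simp only [map_sum, map_smul, LinearMap.sum_apply, LinearMap.smul_apply, slice_tmul,
      innerₛₗ_apply_apply, orthonormal_iff_ite.1 hβ, ite_smul, one_smul, zero_smul, smul_ite,
      smul_zero, Finset.sum_ite_eq, Finset.mem_univ, if_true]
  have hcj : (c j : ℂ) ≠ 0 := by exact_mod_cast (hc j).ne'
  exact (Submodule.smul_mem_iff _ hcj).1 (h ▸ slice_mem_leftSupport _ _)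

end Support

/-! ### Density of the algebra generated by the generators -/

/-- For a star-closed generating set the *-algebra it generates is the plain algebra it generates,
which is dense; no case for `star` is needed. -/
theorem CStarGen.closed_induction {D : Type*} [CStarAlgebra D] {s : Set D}
    (hs : ∀ d ∈ s, star d ∈ s) {P : CStarGen s → Prop}
    (hP : IsClosed {t : CStarGen s | P t})
    (h : ∀ t : CStarGen s, CStarGen.val t ∈ Algebra.adjoin ℂ s → P t) (t : CStarGen s) : P t := by
  let E := (StarAlgebra.adjoin ℂ s).topologicalClosure
  have hss : s ∪ star s = s := by
    rw [Set.union_eq_left]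
    intro d hd
    have := hs _ (Set.mem_star.1 hd)
    rwa [star_star] at this
  have hadj : ∀ d, d ∈ StarAlgebra.adjoin ℂ s ↔ d ∈ Algebra.adjoin ℂ s := fun d => by
    rw [← StarSubalgebra.mem_toSubalgebra, StarAlgebra.adjoin_toSubalgebra, hss]
  let Q : Set E := {t | (t : D) ∈ StarAlgebra.adjoin ℂ s}
  have hQ : Dense Q := by
    intro t
    have h1 : (t : D) ∈ closure (StarAlgebra.adjoin ℂ s : Set D) := t.2
    rw [Topology.IsInducing.subtypeVal.closure_eq_preimage_closure_image]
    refine closure_mono ?_ h1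
    intro d hd
    exact ⟨⟨d, StarSubalgebra.le_topologicalClosure _ hd⟩, hd, rfl⟩
  have hclosed : IsClosed {t : E | P t} := hP
  exact hclosed.closure_subset_iff.2 (fun t ht => h t ((hadj _).1 ht)) (hQ t)

theorem star_universalGen {X A : Type*} [Fintype A] (x : X) (a : A) :
    star (universalGen x a) = universalGen x a := by
  refine Subtype.ext (funext fun ρ => ?_)
  exact (ρ.povm.pos x a).isSelfAdjoint

theorem POVMAlg.closed_induction {X A : Type*} [Fintype A] {P : POVMAlg X A → Prop}
    (hP : IsClosed {t | P t}) (hgen : ∀ x a, P (gen x a))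
    (halg : ∀ c : ℂ, P (algebraMap ℂ _ c)) (hadd : ∀ s t, P s → P t → P (s + t))
    (hmul : ∀ s t, P s → P t → P (s * t)) (t : POVMAlg X A) : P t := by
  refine CStarGen.closed_induction (P := P) ?_ hP (fun t ht => ?_) t
  · rintro _ ⟨⟨x, a⟩, rfl⟩
    exact ⟨(x, a), (star_universalGen x a).symm⟩
  -- The induction runs in the ambient product algebra while `P` concerns the subalgebra, so each
  -- element is carried along with a preimage.
  · have key : ∀ d ∈ Algebra.adjoin ℂ (Set.range fun i : X × A => universalGen i.1 i.2),
        ∃ s : POVMAlg X A, CStarGen.val s = d ∧ P s := by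
      intro d hd
      induction hd using Algebra.adjoin_induction with
      | mem d hd =>
        obtain ⟨⟨x, a⟩, rfl⟩ := hd
        exact ⟨gen x a, rfl, hgen x a⟩
      | algebraMap c => exact ⟨algebraMap ℂ _ c, rfl, halg c⟩
      | add d e _ _ hd he =>
        obtain ⟨s, rfl, hs⟩ := hd
        obtain ⟨t, rfl, ht⟩ := he
        exact ⟨s + t, rfl, hadd s t hs ht⟩
      | mul d e _ _ hd he =>
        obtain ⟨s, rfl, hs⟩ := hd
        obtain ⟨t, rfl, ht⟩ := he
        exact ⟨s * t, rfl, hmul s t hs ht⟩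
    obtain ⟨s, hs, hPs⟩ := key _ ht
    rwa [← Subtype.ext hs]

theorem adjoint_opTensor {H K : Type} [NormedAddCommGroup H] [InnerProductSpace ℂ H]
    [CompleteSpace H] [NormedAddCommGroup K] [InnerProductSpace ℂ K] [CompleteSpace K]
    (S : H →L[ℂ] H) (T : K →L[ℂ] K) :
    ContinuousLinearMap.adjoint (opTensor S T) =
      opTensor (ContinuousLinearMap.adjoint S) (ContinuousLinearMap.adjoint T) := by
  symm
  rw [ContinuousLinearMap.eq_adjoint_iff]
  intro x y
  induction x, y using UniformSpace.Completion.induction_on₂ with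
  | hp => exact isClosed_eq (by fun_prop) (by fun_prop)
  | ih x y =>
    rw [opTensor, opTensor, ContinuousLinearMap.completion_apply_coe,
      ContinuousLinearMap.completion_apply_coe, UniformSpace.Completion.inner_coe,
      UniformSpace.Completion.inner_coe]
    induction x with
    | zero => simp
    | add x x' hx hx' => simp only [map_add, inner_add_left, hx, hx']
    | tmul u v =>
      induction y with
      | zero => simp
      | add y y' hy hy' => simp only [map_add, inner_add_right, hy, hy']
      | tmul u' v' =>
        simp [TensorProduct.inner_tmul, ContinuousLinearMap.adjoint_inner_left]

section MinTensor

variable {A B : Type*} [CStarAlgebra A] [CStarAlgebra B]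

theorem star_universalTmul (a : A) (b : B) :
    star (universalTmul.{0} a b) = universalTmul (star a) (star b) := by
  refine Subtype.ext (funext fun ρ => ?_)
  change star (opTensor (ρ.left a) (ρ.right b)) = opTensor (ρ.left (star a)) (ρ.right (star b))
  rw [map_star, map_star, ContinuousLinearMap.star_eq_adjoint, adjoint_opTensor]
  rfl

theorem opTensor_mul {H K : Type} [NormedAddCommGroup H] [InnerProductSpace ℂ H]
    [NormedAddCommGroup K] [InnerProductSpace ℂ K] (S S' : H →L[ℂ] H) (T T' : K →L[ℂ] K) :
    opTensor (S * S') (T * T') = opTensor S T * opTensor S' T' := by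
  ext z
  induction z using UniformSpace.Completion.induction_on with
  | hp => exact isClosed_eq (by fun_prop) (by fun_prop)
  | ih z =>
    rw [mul_apply_eq_comp, opTensor, opTensor, opTensor,
      ContinuousLinearMap.completion_apply_coe, ContinuousLinearMap.completion_apply_coe,
      ContinuousLinearMap.completion_apply_coe, TensorProduct.mapL_mul, mul_apply_eq_comp]

theorem opTensor_one {H K : Type} [NormedAddCommGroup H] [InnerProductSpace ℂ H]
    [NormedAddCommGroup K] [InnerProductSpace ℂ K] :
    opTensor (1 : H →L[ℂ] H) (1 : K →L[ℂ] K) = 1 := by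
  ext z
  induction z using UniformSpace.Completion.induction_on with
  | hp => exact isClosed_eq (by fun_prop) (by fun_prop)
  | ih z =>
    rw [opTensor, ContinuousLinearMap.completion_apply_coe, QModel.mapL_one_one,
      one_apply_eq_self, one_apply_eq_self]

theorem universalTmul_mul (a a' : A) (b b' : B) :
    universalTmul.{0} (a * a') (b * b') = universalTmul a b * universalTmul a' b' := by
  refine Subtype.ext (funext fun ρ => ?_)
  change opTensor (ρ.left (a * a')) (ρ.right (b * b')) =
    opTensor (ρ.left a) (ρ.right b) * opTensor (ρ.left a') (ρ.right b')
  rw [map_mul, map_mul, opTensor_mul]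

theorem universalTmul_one : universalTmul.{0} (1 : A) (1 : B) = 1 := by
  refine Subtype.ext (funext fun ρ => ?_)
  change opTensor (ρ.left 1) (ρ.right 1) = 1
  rw [map_one, map_one, opTensor_one]

/-- Elementary tensors form a submonoid, so the algebra they generate is their linear span and no
case for products is needed. -/
theorem MinTensor.closed_induction {P : MinTensor.{0} A B → Prop} (hP : IsClosed {t | P t})
    (htmul : ∀ a b, P (tmul a b)) (hzero : P 0) (hadd : ∀ s t, P s → P t → P (s + t))
    (hsmul : ∀ (c : ℂ) t, P t → P (c • t)) (t : MinTensor.{0} A B) : P t := by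
  refine CStarGen.closed_induction (P := P) ?_ hP (fun t ht => ?_) t
  · rintro _ ⟨⟨a, b⟩, rfl⟩
    exact ⟨(star a, star b), (star_universalTmul a b).symm⟩
  · let N : Submonoid (CStarProd (fun ρ : RepPair.{0} A B =>
        HilbertTensor ρ.H ρ.K →L[ℂ] HilbertTensor ρ.H ρ.K)) :=
      { carrier := Set.range fun i : A × B => universalTmul.{0} i.1 i.2
        one_mem' := ⟨(1, 1), universalTmul_one⟩
        mul_mem' := by
          rintro _ _ ⟨⟨a, b⟩, rfl⟩ ⟨⟨a', b'⟩, rfl⟩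
          exact ⟨(a * a', b * b'), universalTmul_mul a a' b b'⟩ }
    have hspan : Subalgebra.toSubmodule (Algebra.adjoin ℂ
        (Set.range fun i : A × B => universalTmul.{0} i.1 i.2)) = Submodule.span ℂ N := by
      rw [Algebra.adjoin_eq_span]
      exact congrArg (fun M => Submodule.span ℂ (SetLike.coe M)) N.closure_eq
    have key : ∀ d ∈ Submodule.span ℂ (N : Set _),
        ∃ s : MinTensor.{0} A B, CStarGen.val s = d ∧ P s := by
      intro d hd
      induction hd using Submodule.span_induction with
      | mem d hd =>
        obtain ⟨⟨a, b⟩, rfl⟩ := hd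
        exact ⟨tmul a b, rfl, htmul a b⟩
      | zero => exact ⟨0, rfl, hzero⟩
      | add d e _ _ hd he =>
        obtain ⟨s, rfl, hs⟩ := hd
        obtain ⟨t, rfl, ht⟩ := he
        exact ⟨s + t, rfl, hadd s t hs ht⟩
      | smul c d _ hd =>
        obtain ⟨s, rfl, hs⟩ := hd
        exact ⟨c • s, rfl, hsmul c s hs⟩
    rw [← Subalgebra.mem_toSubmodule, hspan] at ht
    obtain ⟨s, hs, hPs⟩ := key _ ht
    rwa [← Subtype.ext hs]

end MinTensor

/-! ### Dilations force equal states -/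

namespace QModel

open TensorProduct

variable {X Y A B : Type*} [Fintype A] [Fintype B]

theorem sum_opA (S : QModel X Y A B) (x : X) : ∑ a, S.opA (x, a) = LinearMap.id := by
  ext v
  have := congrArg (fun T : S.HA →L[ℂ] S.HA => T v) (S.M.sum_eq_one x)
  simpa [opA, LinearMap.sum_apply, _root_.sum_apply] using this

theorem sum_opB (S : QModel X Y A B) (y : Y) : ∑ b, S.opB (y, b) = LinearMap.id := by
  ext v
  have := congrArg (fun T : S.HB →L[ℂ] S.HB => T v) (S.N.sum_eq_one y)
  simpa [opB, LinearMap.sum_apply, _root_.sum_apply] using this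

theorem sum_map_opB (S : QModel X Y A B) (i : X × A) (y : Y) (z : S.HA ⊗[ℂ] S.HB) :
    ∑ b, TensorProduct.map (S.opA i) (S.opB (y, b)) z = (S.opA i).rTensor _ z := by
  have h := map_sum (TensorProduct.mapBilinear (RingHom.id ℂ) S.HA S.HB S.HA S.HB (S.opA i))
    (fun b => S.opB (y, b)) Finset.univ
  rw [sum_opB] at h
  exact ((LinearMap.congr_fun h z).trans (LinearMap.sum_apply _ _ _)).symm

theorem sum_map_opA (S : QModel X Y A B) (x : X) (j : Y × B) (z : S.HA ⊗[ℂ] S.HB) :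
    ∑ a, TensorProduct.map (S.opA (x, a)) (S.opB j) z = (S.opB j).lTensor _ z := by
  have h := map_sum ((TensorProduct.mapBilinear (RingHom.id ℂ) S.HA S.HB S.HA S.HB).flip
    (S.opB j)) (fun a => S.opA (x, a)) Finset.univ
  rw [sum_opA] at h
  exact ((LinearMap.congr_fun h z).trans (LinearMap.sum_apply _ _ _)).symm

theorem sum_rTensor_opA (S : QModel X Y A B) (x : X) (z : S.HA ⊗[ℂ] S.HB) :
    ∑ a, (S.opA (x, a)).rTensor _ z = z := by
  have h := map_sum (LinearMap.rTensorHom S.HB) (fun a => S.opA (x, a)) Finset.univ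
  rw [sum_opA] at h
  have h2 := (LinearMap.congr_fun h z).trans (LinearMap.sum_apply _ _ _)
  exact h2.symm.trans (LinearMap.rTensor_id_apply _ _ z)

/-- The data of a local dilation, in a form that separates the two sides. -/
structure Dilation (S T : QModel X Y A B) where
  KA : Type
  KB : Type
  [normedA : NormedAddCommGroup KA]
  [innerA : InnerProductSpace ℂ KA]
  [finA : FiniteDimensional ℂ KA]
  [normedB : NormedAddCommGroup KB]
  [innerB : InnerProductSpace ℂ KB]
  [finB : FiniteDimensional ℂ KB]
  aux : KA ⊗[ℂ] KB
  IA : S.HA →ₗᵢ[ℂ] T.HA ⊗[ℂ] KA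
  IB : S.HB →ₗᵢ[ℂ] T.HB ⊗[ℂ] KB
  norm_aux : ‖aux‖ = 1
  map_vector : TensorProduct.map IA.toLinearMap IB.toLinearMap S.ψ =
    tensorTensorTensorComm ℂ T.HA T.HB KA KB (T.ψ ⊗ₜ[ℂ] aux)
  map_opA : ∀ i, TensorProduct.map IA.toLinearMap IB.toLinearMap ((S.opA i).rTensor _ S.ψ) =
    tensorTensorTensorComm ℂ T.HA T.HB KA KB ((T.opA i).rTensor _ T.ψ ⊗ₜ[ℂ] aux)
  map_opB : ∀ j, TensorProduct.map IA.toLinearMap IB.toLinearMap ((S.opB j).lTensor _ S.ψ) =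
    tensorTensorTensorComm ℂ T.HA T.HB KA KB ((T.opB j).lTensor _ T.ψ ⊗ₜ[ℂ] aux)

attribute [instance] Dilation.normedA Dilation.innerA Dilation.finA
  Dilation.normedB Dilation.innerB Dilation.finB

/-- A POVM sums to `1`, so summing the dilation identity over the outcomes of one party at a fixed
input removes that party's operator; doing this for both leaves the vectors. -/
theorem LocallyDilatesTo.nonempty_dilation [Nonempty X] [Nonempty Y] {S T : QModel X Y A B}
    (h : S.LocallyDilatesTo T) : Nonempty (Dilation S T) := by
  obtain ⟨KA, KB, _, _, _, _, _, _, aux, IA, IB, haux, h⟩ := h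
  obtain ⟨x₀⟩ := ‹Nonempty X›
  obtain ⟨y₀⟩ := ‹Nonempty Y›
  simp only [mapL_op_eq_map] at h
  have hA : ∀ i, TensorProduct.map IA.toLinearMap IB.toLinearMap ((S.opA i).rTensor _ S.ψ) =
      tensorTensorTensorComm ℂ T.HA T.HB KA KB ((T.opA i).rTensor _ T.ψ ⊗ₜ[ℂ] aux) := fun i => by
    rw [← sum_map_opB S i y₀, ← sum_map_opB T i y₀, map_sum, sum_tmul, map_sum]
    exact Finset.sum_congr rfl fun b _ => h i.2 b i.1 y₀
  have hB : ∀ j, TensorProduct.map IA.toLinearMap IB.toLinearMap ((S.opB j).lTensor _ S.ψ) =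
      tensorTensorTensorComm ℂ T.HA T.HB KA KB ((T.opB j).lTensor _ T.ψ ⊗ₜ[ℂ] aux) := fun j => by
    rw [← sum_map_opA S x₀ j, ← sum_map_opA T x₀ j, map_sum, sum_tmul, map_sum]
    exact Finset.sum_congr rfl fun a _ => h a j.2 x₀ j.1
  refine ⟨⟨KA, KB, aux, IA, IB, haux, ?_, hA, hB⟩⟩
  conv_lhs => rw [← sum_rTensor_opA S x₀ S.ψ]
  conv_rhs => rw [← sum_rTensor_opA T x₀ T.ψ]
  rw [map_sum, sum_tmul, map_sum]
  exact Finset.sum_congr rfl fun a _ => hA (x₀, a)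

namespace Dilation

variable {S T : QModel X Y A B} (D : Dilation S T)

theorem aux_ne_zero : D.aux ≠ 0 := fun h => by
  have := D.norm_aux
  simp [h] at this

theorem comm_map {H K H' K' : Type*} [AddCommGroup H] [Module ℂ H] [AddCommGroup K] [Module ℂ K]
    [AddCommGroup H'] [Module ℂ H'] [AddCommGroup K'] [Module ℂ K'] (f : H →ₗ[ℂ] H')
    (g : K →ₗ[ℂ] K') (z : H ⊗[ℂ] K) :
    TensorProduct.map g f (TensorProduct.comm ℂ _ _ z) =
      TensorProduct.comm ℂ _ _ (TensorProduct.map f g z) := by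
  induction z with
  | zero => simp
  | add z z' hz hz' => simp only [map_add, hz, hz']
  | tmul h k => simp

/-- Swapping the tensor factors lets the results on left supports serve the second party as well. -/
theorem comm_map_vector : TensorProduct.map D.IB.toLinearMap D.IA.toLinearMap
      (TensorProduct.comm ℂ _ _ S.ψ) =
    tensorTensorTensorComm ℂ T.HB T.HA D.KB D.KA
      (TensorProduct.comm ℂ _ _ T.ψ ⊗ₜ[ℂ] TensorProduct.comm ℂ _ _ D.aux) := by
  rw [comm_map, D.map_vector, comm_tensorTensorTensorComm]

theorem comm_map_opB (j : Y × B) : TensorProduct.map D.IB.toLinearMap D.IA.toLinearMap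
      ((S.opB j).rTensor _ (TensorProduct.comm ℂ _ _ S.ψ)) =
    tensorTensorTensorComm ℂ T.HB T.HA D.KB D.KA
      ((T.opB j).rTensor _ (TensorProduct.comm ℂ _ _ T.ψ) ⊗ₜ[ℂ]
        TensorProduct.comm ℂ _ _ D.aux) := by
  have h : ∀ S : QModel X Y A B, (S.opB j).rTensor _ (TensorProduct.comm ℂ _ _ S.ψ) =
      TensorProduct.comm ℂ _ _ ((S.opB j).lTensor _ S.ψ) := fun S => comm_map _ _ _
  rw [h, h, comm_map, D.map_opB, comm_tensorTensorTensorComm]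

end Dilation

/-- The support of the vector on either side is invariant under the operators of the model. -/
def IsCentrallySupported (S : QModel X Y A B) : Prop :=
  (∀ i, ∀ v ∈ leftSupport S.ψ, S.opA i v ∈ leftSupport S.ψ) ∧
  (∀ j, ∀ v ∈ leftSupport (TensorProduct.comm ℂ _ _ S.ψ),
    S.opB j v ∈ leftSupport (TensorProduct.comm ℂ _ _ S.ψ))

theorem IsFullRank.leftSupport_eq_top {S : QModel X Y A B} (h : S.IsFullRank) :
    leftSupport S.ψ = ⊤ ∧ leftSupport (TensorProduct.comm ℂ _ _ S.ψ) = ⊤ := by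
  obtain ⟨hd, c, α, β, hc, hα, hβ, hψ⟩ := h
  rw [hψ]
  refine ⟨leftSupport_eq_top_of_sum rfl hc hα.linearIndependent hβ, ?_⟩
  simp only [map_sum, map_smul, TensorProduct.comm_tmul]
  exact leftSupport_eq_top_of_sum hd hc hβ.linearIndependent hα

theorem Dilation.isCentrallySupported_of_isFullRank {S T : QModel X Y A B} (D : Dilation S T)
    (h : S.IsFullRank) : T.IsCentrallySupported := by
  obtain ⟨h1, h2⟩ := h.leftSupport_eq_top
  refine ⟨fun i => leftSupport_invariant_of_eq_top D.IB.injective D.aux_ne_zero h1 D.map_vector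
    (D.map_opA i), fun j => leftSupport_invariant_of_eq_top D.IA.injective ?_ h2
    D.comm_map_vector (D.comm_map_opB j)⟩
  exact fun h => D.aux_ne_zero ((TensorProduct.comm ℂ _ _).map_eq_zero_iff.1 h)

/-- The elements with both properties form a closed subalgebra containing the generators. The two
are proved together because the product step applies the relation at `POVMAlg.lift M t v`, which
must again lie in `E`. -/
theorem _root_.QSelfTest.POVMAlg.lift_intertwines {X A : Type*} [Fintype A] {H V K : Type}
    [NormedAddCommGroup H] [InnerProductSpace ℂ H] [FiniteDimensional ℂ H] [CompleteSpace H]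
    [Nontrivial H] [NormedAddCommGroup V] [InnerProductSpace ℂ V] [FiniteDimensional ℂ V]
    [CompleteSpace V] [Nontrivial V] [NormedAddCommGroup K] [InnerProductSpace ℂ K]
    [FiniteDimensional ℂ K] (M : POVMFamily X A H) (N : POVMFamily X A V) (E : Submodule ℂ H)
    (I : H →ₗ[ℂ] V ⊗[ℂ] K) (hE : ∀ x a, ∀ v ∈ E, M.op x a v ∈ E)
    (hI : ∀ x a, ∀ v ∈ E, I (M.op x a v) = (N.op x a).toLinearMap.rTensor K (I v))
    (t : POVMAlg X A) : (∀ v ∈ E, POVMAlg.lift M t v ∈ E) ∧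
      ∀ v ∈ E, I (POVMAlg.lift M t v) = (POVMAlg.lift N t).toLinearMap.rTensor K (I v) := by
  have hM : Continuous (POVMAlg.lift M) := by
    open scoped CStarAlgebra in exact map_continuous _
  have hN : Continuous (POVMAlg.lift N) := by
    open scoped CStarAlgebra in exact map_continuous _
  have hsmul : ∀ (c : ℂ) (z : V ⊗[ℂ] K),
      ((c • (1 : V →L[ℂ] V)).toLinearMap).rTensor K z = c • z := fun c z => by
    rw [ContinuousLinearMap.toLinearMap_smul, LinearMap.rTensor_smul, LinearMap.smul_apply]
    exact congrArg _ (LinearMap.rTensor_id_apply _ _ z)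
  induction t using POVMAlg.closed_induction with
  | hP =>
    have h1 : IsClosed {t | ∀ v ∈ E, POVMAlg.lift M t v ∈ E} := by
      simp only [Set.ofPred_forall]
      refine isClosed_biInter fun v _ => ?_
      exact E.closed_of_finiteDimensional.preimage (hM.clm_apply continuous_const)
    have h2 : IsClosed {t | ∀ v ∈ E, I (POVMAlg.lift M t v) =
        (POVMAlg.lift N t).toLinearMap.rTensor K (I v)} := by
      simp only [Set.ofPred_forall]
      refine isClosed_biInter fun v _ => ?_
      refine isClosed_eq ?_ ?_
      · exact I.continuous_of_finiteDimensional.comp (hM.clm_apply continuous_const)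
      · have h3 : Continuous fun f : V →L[ℂ] V => f.toLinearMap.rTensor K (I v) := by
          let L : (V →L[ℂ] V) →ₗ[ℂ] V ⊗[ℂ] K := LinearMap.applyₗ (I v) ∘ₗ
            LinearMap.rTensorHom K ∘ₗ ContinuousLinearMap.coeLM ℂ
          exact L.continuous_of_finiteDimensional
        exact h3.comp hN
    exact h1.inter h2
  | hgen x a => exact ⟨hE x a, hI x a⟩
  | halg c =>
    rw [AlgHomClass.commutes, AlgHomClass.commutes, Algebra.algebraMap_eq_smul_one,
      Algebra.algebraMap_eq_smul_one]
    exact ⟨fun v hv => E.smul_mem c hv, fun v _ => (map_smul I c v).trans (hsmul c _).symm⟩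
  | hadd s t hs ht =>
    refine ⟨fun v hv => ?_, fun v hv => ?_⟩
    · rw [map_add]
      exact E.add_mem (hs.1 v hv) (ht.1 v hv)
    · rw [map_add (POVMAlg.lift M), map_add (POVMAlg.lift N), _root_.add_apply,
        ContinuousLinearMap.toLinearMap_add, LinearMap.rTensor_add, LinearMap.add_apply,
        ← hs.2 v hv, ← ht.2 v hv, map_add I]
  | hmul s t hs ht =>
    refine ⟨fun v hv => ?_, fun v hv => ?_⟩
    · rw [map_mul]
      exact hs.1 _ (ht.1 v hv)
    · rw [map_mul, map_mul]
      refine (hs.2 _ (ht.1 v hv)).trans ?_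
      rw [ht.2 v hv, ← LinearMap.comp_apply, ← LinearMap.rTensor_comp]
      rfl

/-- Model states are continuous and elementary tensors span a dense subspace. -/
theorem state_ext {S T : QModel X Y A B}
    (h : ∀ a b, S.state.toFun (MinTensor.tmul a b) = T.state.toFun (MinTensor.tmul a b)) :
    S.state = T.state := by
  have hcont : ∀ S : QModel X Y A B, Continuous S.state.toFun := fun S => by
    have h1 : Continuous S.assocRep := by
      open scoped CStarAlgebra in exact map_continuous _
    exact continuous_const.inner (h1.clm_apply continuous_const)
  have key : ∀ t, S.state.toFun t = T.state.toFun t := fun t => by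
    induction t using MinTensor.closed_induction with
    | hP => exact isClosed_eq (hcont S) (hcont T)
    | htmul a b => exact h a b
    | hzero => rw [map_zero, map_zero]
    | hadd s t hs ht => rw [map_add, map_add, hs, ht]
    | hsmul c t ht => rw [map_smul, map_smul, ht]
  have hfun : S.state.toFun = T.state.toFun := LinearMap.ext key
  cases hS : S.state
  cases hT : T.state
  rw [hS, hT] at hfun
  cases hfun
  rfl

theorem Dilation.state_eq {S T : QModel X Y A B} (D : Dilation S T)
    (hT : T.IsCentrallySupported) : S.state = T.state := by
  refine state_ext fun a b => ?_
  have hA := POVMAlg.lift_intertwines S.M T.M (leftSupport S.ψ) D.IA.toLinearMap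
    (fun x a => leftSupport_invariant_of_dilation D.IA.injective D.IB.injective (hT.1 (x, a))
      D.map_vector (D.map_opA (x, a)))
    (fun x a => intertwines_on_leftSupport D.IB.injective D.map_vector (D.map_opA (x, a))) a
  have hB := POVMAlg.lift_intertwines S.N T.N (leftSupport (TensorProduct.comm ℂ _ _ S.ψ))
    D.IB.toLinearMap
    (fun y b => leftSupport_invariant_of_dilation D.IB.injective D.IA.injective (hT.2 (y, b))
      D.comm_map_vector (D.comm_map_opB (y, b)))
    (fun y b => intertwines_on_leftSupport D.IA.injective D.comm_map_vector
      (D.comm_map_opB (y, b))) b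
  set ma := (POVMAlg.lift S.M a).toLinearMap
  set nb := (POVMAlg.lift S.N b).toLinearMap
  set ma' := (POVMAlg.lift T.M a).toLinearMap
  set nb' := (POVMAlg.lift T.N b).toLinearMap
  have key : TensorProduct.map D.IA.toLinearMap D.IB.toLinearMap (TensorProduct.map ma nb S.ψ) =
      tensorTensorTensorComm ℂ T.HA T.HB D.KA D.KB (TensorProduct.map ma' nb' T.ψ ⊗ₜ D.aux) := by
    -- The two legs are exchanged one at a time, each agreeing only on the support of `ψ` on its own
    -- side.
    have h1 : TensorProduct.map (D.IA.toLinearMap ∘ₗ ma) (D.IB.toLinearMap ∘ₗ nb) S.ψ =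
        TensorProduct.map (ma'.rTensor D.KA ∘ₗ D.IA.toLinearMap) (D.IB.toLinearMap ∘ₗ nb) S.ψ :=
      map_congr_of_eqOn_leftSupport hA.2 _
    have h2 : TensorProduct.map (D.IB.toLinearMap ∘ₗ nb) (ma'.rTensor D.KA ∘ₗ D.IA.toLinearMap)
          (TensorProduct.comm ℂ _ _ S.ψ) =
        TensorProduct.map (nb'.rTensor D.KB ∘ₗ D.IB.toLinearMap)
          (ma'.rTensor D.KA ∘ₗ D.IA.toLinearMap) (TensorProduct.comm ℂ _ _ S.ψ) :=
      map_congr_of_eqOn_leftSupport hB.2 _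
    rw [Dilation.comm_map, Dilation.comm_map] at h2
    have h3 := h1.trans ((TensorProduct.comm ℂ _ _).injective h2)
    rw [TensorProduct.map_comp, TensorProduct.map_comp, LinearMap.comp_apply,
      LinearMap.comp_apply, D.map_vector, map_rTensor_tensorTensorTensorComm] at h3
    exact h3
  rw [state_tmul, state_tmul, mapL_apply, mapL_apply]
  -- Pairing with the image of `ψ` itself lets `aux` contribute only the factor `‖aux‖ ^ 2 = 1`.
  have h1 := TensorProduct.inner_map_map D.IA D.IB S.ψ (TensorProduct.map ma nb S.ψ)
  have h2 := inner_tensorTensorTensorComm T.ψ (TensorProduct.map ma' nb' T.ψ) D.aux D.aux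
  rw [inner_self_tensor, D.norm_aux, Complex.ofReal_one, one_pow, mul_one] at h2
  rw [← D.map_vector, ← key] at h2
  exact h1.symm.trans h2

/-- The full-rank model serves only to show that the ideal model `T` is centrally supported; every
other model is then compared with `T` directly. -/
theorem isAbstractStateSelfTest_of_isSelfTest [Nonempty X] [Nonempty Y]
    {p : A → B → X → Y → ℝ} {𝒞 : Set (QModel X Y A B)}
    (hfull : ∃ S ∈ 𝒞, S.IsModelFor p ∧ S.IsFullRank) (h : IsSelfTest p 𝒞) :
    IsAbstractStateSelfTest p {f | ∃ S ∈ 𝒞, S.state = f} := by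
  obtain ⟨S, hS𝒞, hS, hfull⟩ := hfull
  obtain ⟨T, hT𝒞, hT, hdil⟩ := h
  have hsupp : T.IsCentrallySupported := by
    obtain ⟨D⟩ := (hdil S hS𝒞 hS).nonempty_dilation
    exact D.isCentrallySupported_of_isFullRank hfull
  refine ⟨T.state, ⟨⟨T, hT𝒞, rfl⟩, (T.hasCorrelation_state_iff p).2 hT⟩, ?_⟩
  rintro _ ⟨⟨S', hS'𝒞, rfl⟩, hS'⟩
  obtain ⟨D⟩ := (hdil S' hS'𝒞 ((S'.hasCorrelation_state_iff p).1 hS')).nonempty_dilation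
  exact D.state_eq hsupp

end QModel

end QSelfTest

end

theorem theorem3p5 {X Y A B : Type*} [Fintype X] [Fintype Y] [Fintype A] [Fintype B]
    [Nonempty X] [Nonempty Y] (p : A → B → X → Y → ℝ)
    (𝒞 : Set (QSelfTest.QModel X Y A B)) (h𝒞 : QSelfTest.IsClosedClass 𝒞) :
    -- the equivalence
    (p ∈ (QSelfTest.Cq X Y A B).extremePoints ℝ →
      (∃ S ∈ 𝒞, S.IsModelFor p ∧ S.IsFullRank) →
      (QSelfTest.IsSelfTest p 𝒞 ↔
        QSelfTest.IsAbstractStateSelfTest p {f | ∃ S ∈ 𝒞, S.state = f})) ∧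
    -- the "if" direction, without a full-rank model
    (p ∈ (QSelfTest.Cq X Y A B).extremePoints ℝ →
      QSelfTest.IsAbstractStateSelfTest p {f | ∃ S ∈ 𝒞, S.state = f} →
      QSelfTest.IsSelfTest p 𝒞) ∧
    -- the "only if" direction, without extremality
    ((∃ S ∈ 𝒞, S.IsModelFor p ∧ S.IsFullRank) →
      QSelfTest.IsSelfTest p 𝒞 →
      QSelfTest.IsAbstractStateSelfTest p {f | ∃ S ∈ 𝒞, S.state = f}) := by
  have h2 := fun hp h => QSelfTest.QModel.isSelfTest_of_isAbstractStateSelfTest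
    (p := p) hp h𝒞 h
  have h3 := fun hfull h => QSelfTest.QModel.isAbstractStateSelfTest_of_isSelfTest
    (p := p) (𝒞 := 𝒞) hfull h
  exact ⟨fun hp hfull => ⟨h3 hfull, h2 hp⟩, h2, h3⟩
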